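/- Let $n\ge 2$. Then $\mathrm{Proj}^-_{\mathbb{R}^n}\equiv_{\mathrm{sW}}\mathrm{BWT}_{\mathbb{R}}$, that is, $\mathrm{Proj}^-_{\mathbb{R}^n}\le_{\mathrm{sW}}\mathrm{BWT}_{\mathbb{R}}$ and $\mathrm{BWT}_{\mathbb{R}}\le_{\mathrm{sW}}\mathrm{Proj}^-_{\mathbb{R}^n}$, with the following notions. A representation of a set $X$ is a surjective partial function $\delta_X:\subseteq\mathbb{N}^{\mathbb{N}}\to X$; $p$ is a name of $x$ if $\delta_X(p)=x$. Pairs and sequences are represented by $\langle p_0,p_1\rangle$ and $\langle p_0,p_1,\dots\rangle$, using the usual computable (un)pairing. A partial multi-valued function $f:\subseteq X\rightrightarrows Y$ assigns to each $x\in X$ a set $f(x)\subseteq Y$, and $\mathrm{dom}(f)=\{x: f(x)\neq\emptyset\}$. A partial function $F:\subseteq\mathbb{N}^{\mathbb{N}}\to\mathbb{N}^{\mathbb{N}}$ realizes $f$ between represented spaces if $\delta_Y(F(p))\in f(\delta_X(p))$ for every name $p$ of a point of $\mathrm{dom}(f)$. We write $f\le_{\mathrm{sW}}g$ if there are computable (by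 a type-two Turing machine) partial functions $H,K:\subseteq\mathbb{N}^{\mathbb{N}}\to\mathbb{N}^{\mathbb{N}}$ such that $K\circ G\circ H$ realizes $f$ whenever $G$ realizes $g$. $\mathbb{R}^m$ carries the Euclidean metric $d$ and an effective enumeration $\alpha:\mathbb{N}\to\mathbb{Q}^m$ of $\mathbb{Q}^m$. In the Cauchy representation, $p$ is a name of $x$ if $d(\alpha(p(i)),\alpha(p(j)))\le 2^{-i}$ for all $i\le j$ and $\lim_i\alpha(p(i))=x$. The space $\mathcal{A}_-(\mathbb{R}^m)$ is the set of closed subsets of $\mathbb{R}^m$, where $p$ is a name of $A$ if $A=\mathbb{R}^m\setminus\bigcup_i B_{p(i)}$; here $B_{\langle k,l\rangle}=B(\alpha(k),q_l)$ is an open ball and $(q_l)_l$ is an effective enumeration of the nonnegative rationals. $\mathrm{Proj}^-_{\mathbb{R}^n}:\subseteq\mathbb{R}^n\times\mathcal{A}_-(\mathbb{R}^n)\rightrightarrows\mathbb{R}^n$ maps $(x,A)$ with $A\ne\emptyset$ to $\{y\in A: d(x,y)=\inf_{z\in A}d(x,z)\}$. $\mathrm{BWT}_{\mathbb{R}}:\subseteq\mathbb{R}^{\mathbb{N}}\rightrightarrows\mathbb{R}$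 maps each sequence whose range has compact closure to the set of its accumulation points, that is, the limits of its convergent subsequences. -/

import Mathlib

open Filter Topology TopologicalSpace

/-! ### Type-two computability on Baire space `ℕ → ℕ` -/

/-- A type-two machine (transducer on infinite sequences).  It reads its input sequence one symbol
after another; on reading a symbol it carries out a terminating computation that updates its memory
(an arbitrary effectively coded object) and appends a finite, possibly empty, word to its one-way
output tape.  Output that has been written is never revised. -/
structure TypeTwoMachine where
  State : Type
  [primcodable : Primcodable State]
  init : State
  step : State → ℕ → State × List ℕ
  computable_step : Computable₂ step

namespace TypeTwoMachine

/-- Memory and output tape of `M` after it has read the first `k` symbols of `p`. -/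
def config (M : TypeTwoMachine) (p : ℕ → ℕ) : ℕ → M.State × List ℕ
  | 0 => (M.init, [])
  | k + 1 =>
    ((M.step (M.config p k).1 (p k)).1, (M.config p k).2 ++ (M.step (M.config p k).1 (p k)).2)

/-- On input `p` the machine `M` writes, in the long run, the infinite sequence `q`: every symbol
of `q` is eventually written at its place.  (The tape only grows, so `q` is unique.) -/
def Produces (M : TypeTwoMachine) (p q : ℕ → ℕ) : Prop :=
  ∀ n, ∃ k, (M.config p k).2[n]? = some (q n)

end TypeTwoMachine

/-- A partial function on Baire space is computable if some type-two machine produces `F p` on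
every input `p` in the domain of `F`. -/
def BaireComputable (F : (ℕ → ℕ) →. (ℕ → ℕ)) : Prop :=
  ∃ M : TypeTwoMachine, ∀ p, ∀ q ∈ F p, M.Produces p q

/-! ### Represented spaces -/

/-- A representation of `X`: a surjective partial function from Baire space to `X`, given by its
graph; `IsName p x` says that `p` is a name of `x`. -/
structure BaireRepresentation (X : Type*) where
  IsName : (ℕ → ℕ) → X → Prop
  unique : ∀ {p x y}, IsName p x → IsName p y → x = y
  surjective : ∀ x, ∃ p, IsName p x

namespace BaireRepresentation

/-- Product representation: `⟨p₀, p₁⟩(2 i) = p₀(i)` and `⟨p₀, p₁⟩(2 i + 1) = p₁(i)`. -/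
def prod {X Y : Type*} (δ : BaireRepresentation X) (ε : BaireRepresentation Y) :
    BaireRepresentation (X × Y) where
  IsName p z := δ.IsName (fun i => p (2 * i)) z.1 ∧ ε.IsName (fun i => p (2 * i + 1)) z.2
  unique h h' := Prod.ext (δ.unique h.1 h'.1) (ε.unique h.2 h'.2)
  surjective z := by
    obtain ⟨p, hp⟩ := δ.surjective z.1
    obtain ⟨q, hq⟩ := ε.surjective z.2
    refine ⟨fun i => if i % 2 = 0 then p (i / 2) else q (i / 2), ?_, ?_⟩
    · convert hp using 1
      funext i
      simp
    · convert hq using 1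
      funext i
      have h1 : (2 * i + 1) % 2 = 1 := by omega
      have h2 : (2 * i + 1) / 2 = i := by omega
      simp [h1, h2]

/-- Representation of sequences: `⟨p₀, p₁, …⟩⟨i, j⟩ = pᵢ(j)`. -/
def seq {X : Type*} (δ : BaireRepresentation X) : BaireRepresentation (ℕ → X) where
  IsName p s := ∀ i, δ.IsName (fun j => p (Nat.pair i j)) (s i)
  unique h h' := funext fun i => δ.unique (h i) (h' i)
  surjective s := by
    choose p hp using fun i => δ.surjective (s i)
    exact ⟨fun k => p k.unpair.1 k.unpair.2, fun i => by simpa using hp i⟩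

end BaireRepresentation

/-! ### Partial multi-valued functions and strong Weihrauch reducibility -/

/-- A partial multi-valued function between represented spaces; `x` belongs to its domain
if and only if `sol x` is nonempty. -/
structure Problem where
  Input : Type
  Output : Type
  inRep : BaireRepresentation Input
  outRep : BaireRepresentation Output
  sol : Input → Set Output

/-- `F` is a realizer of `f`: it maps every name of every `x ∈ dom f` to a name of some
element of `f(x)`. -/
def Problem.Realizes (f : Problem) (F : (ℕ → ℕ) →. (ℕ → ℕ)) : Prop :=
  ∀ p x, f.inRep.IsName p x → (f.sol x).Nonempty →
    ∃ q ∈ F p, ∃ y ∈ f.sol x, f.outRep.IsName q y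

/-- Strong Weihrauch reducibility `f ≤ g`: there are computable `H`, `K` such that `K ∘ G ∘ H`
realizes `f` whenever `G` realizes `g`. -/
def StrongWeihrauchReducible (f g : Problem) : Prop :=
  ∃ H K : (ℕ → ℕ) →. (ℕ → ℕ), BaireComputable H ∧ BaireComputable K ∧
    ∀ G : (ℕ → ℕ) →. (ℕ → ℕ), g.Realizes G → f.Realizes (K.comp (G.comp H))

/-- Strong Weihrauch equivalence. -/
def StrongWeihrauchEquiv (f g : Problem) : Prop :=
  StrongWeihrauchReducible f g ∧ StrongWeihrauchReducible g f

/-! ### Metric spaces with a dense sequence: points and closed sets -/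

noncomputable section

/-- An explicit enumeration of the nonnegative rational numbers. -/
def nnratEnum (m : ℕ) : ℚ := (m.unpair.1 : ℚ) / ((m.unpair.2 : ℚ) + 1)

/-- An explicit enumeration of the rational numbers: `⟨⟨a, b⟩, c⟩ ↦ (a - b) / (c + 1)`. -/
def ratEnum (m : ℕ) : ℚ :=
  ((m.unpair.1.unpair.1 : ℚ) - (m.unpair.1.unpair.2 : ℚ)) / ((m.unpair.2 : ℚ) + 1)

theorem nnratEnum_surj (q : ℚ) (hq : 0 ≤ q) : ∃ m, nnratEnum m = q := by
  refine ⟨Nat.pair q.num.toNat (q.den - 1), ?_⟩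
  have hd : ((q.den - 1 : ℕ) : ℚ) + 1 = q.den := by
    have := q.den_pos
    exact_mod_cast Nat.sub_add_cancel this
  have hn : ((q.num.toNat : ℕ) : ℚ) = q.num := by
    exact_mod_cast Int.toNat_of_nonneg (Rat.num_nonneg.mpr hq)
  simp only [nnratEnum, Nat.unpair_pair]
  rw [hd, hn, Rat.num_div_den]

theorem ratEnum_surj (q : ℚ) : ∃ m, ratEnum m = q := by
  refine ⟨Nat.pair (Nat.pair q.num.toNat (-q.num).toNat) (q.den - 1), ?_⟩
  have hd : ((q.den - 1 : ℕ) : ℚ) + 1 = q.den := by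
    have := q.den_pos
    exact_mod_cast Nat.sub_add_cancel this
  have hn : ((q.num.toNat : ℕ) : ℚ) - (((-q.num).toNat : ℕ) : ℚ) = q.num := by
    exact_mod_cast Int.toNat_sub_toNat_neg q.num
  simp only [ratEnum, Nat.unpair_pair]
  rw [hd, hn, Rat.num_div_den]

/-- A dense sequence in a metric space, the datum from which names of points and of closed sets are
formed.  (For the spaces `ℝ` and `ℝⁿ` below, with explicit enumerations of `ℚ` and `ℚⁿ`, the distances
of its points are a computable double sequence, so these are computable metric spaces.) -/
structure DenseSequence (X : Type*) [MetricSpace X] where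
  pt : ℕ → X
  dense : DenseRange pt

namespace DenseSequence

variable {X : Type*} [MetricSpace X] (α : DenseSequence X)

/-- The Cauchy representation: `p` is a name of `x` if `(α(p i))ᵢ` is an effective Cauchy
sequence with limit `x`. -/
def cauchyRep : BaireRepresentation X where
  IsName p x := (∀ i j, i ≤ j → dist (α.pt (p i)) (α.pt (p j)) ≤ (2 : ℝ)⁻¹ ^ i) ∧
    Tendsto (fun i => α.pt (p i)) atTop (𝓝 x)
  unique h h' := tendsto_nhds_unique h.2 h'.2
  surjective x := by
    have hpos : ∀ i : ℕ, (0 : ℝ) < (2 : ℝ)⁻¹ ^ (i + 1) := fun i => by positivity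
    choose p hp using fun i : ℕ => α.dense.exists_dist_lt x (hpos i)
    refine ⟨p, fun i j hij => ?_, ?_⟩
    · have h1 := dist_triangle_left (α.pt (p i)) (α.pt (p j)) x
      have h2 : (2 : ℝ)⁻¹ ^ (j + 1) ≤ (2 : ℝ)⁻¹ ^ (i + 1) :=
        pow_le_pow_of_le_one (by norm_num) (by norm_num) (by omega)
      have h3 : (2 : ℝ)⁻¹ ^ (i + 1) + (2 : ℝ)⁻¹ ^ (i + 1) = (2 : ℝ)⁻¹ ^ i := by
        rw [pow_succ]; ring
      linarith [hp i, hp j]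
    · rw [tendsto_iff_dist_tendsto_zero]
      have hlim : Tendsto (fun i : ℕ => (2 : ℝ)⁻¹ ^ (i + 1)) atTop (𝓝 0) :=
        (tendsto_pow_atTop_nhds_zero_of_lt_one (by norm_num) (by norm_num)).comp
          (tendsto_add_atTop_nat 1)
      refine squeeze_zero (fun _ => dist_nonneg) (fun i => ?_) hlim
      rw [dist_comm]
      exact (hp i).le

/-- The basic open balls: `B_⟨n, m⟩ = B(α(n), q_m)`, where `q` enumerates the nonnegative
rationals. -/
def basicBall (k : ℕ) : Set X := Metric.ball (α.pt k.unpair.1) (nnratEnum k.unpair.2 : ℝ)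

theorem exists_basicBall {U : Set X} (hU : IsOpen U) {x : X} (hx : x ∈ U) :
    ∃ k, x ∈ α.basicBall k ∧ α.basicBall k ⊆ U := by
  obtain ⟨ε, hε, hb⟩ := Metric.isOpen_iff.mp hU x hx
  obtain ⟨r, hr0, hr⟩ := exists_rat_btwn (half_pos hε)
  have hr0' : (0 : ℚ) ≤ r := by exact_mod_cast hr0.le
  obtain ⟨n, hn⟩ := α.dense.exists_dist_lt x hr0
  obtain ⟨m, hm⟩ := nnratEnum_surj r hr0'
  refine ⟨Nat.pair n m, ?_, fun y hy => hb ?_⟩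
  · simpa [basicBall, hm] using hn
  · have hy' : dist y (α.pt n) < r := by simpa [basicBall, hm] using hy
    have := dist_triangle_right y x (α.pt n)
    rw [Metric.mem_ball]
    linarith

/-- Negative information on closed sets: `p` is a name of `A` if `A` is the complement of the
union of the basic open balls `B_{p(i)}`. -/
def negRep : BaireRepresentation (Closeds X) where
  IsName p A := (A : Set X) = (⋃ i, α.basicBall (p i))ᶜ
  unique h h' := SetLike.coe_injective (h.trans h'.symm)
  surjective A := by
    classical
    obtain ⟨z, hz⟩ := nnratEnum_surj 0 le_rfl
    have hempty : α.basicBall (Nat.pair 0 z) = ∅ := by simp [basicBall, hz]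
    refine ⟨fun k => if α.basicBall k ⊆ (A : Set X)ᶜ then k else Nat.pair 0 z, ?_⟩
    rw [eq_compl_comm]
    apply Set.Subset.antisymm
    · refine Set.iUnion_subset fun k => ?_
      by_cases h : α.basicBall k ⊆ (A : Set X)ᶜ
      · simpa only [if_pos h] using h
      · simp only [if_neg h, hempty, Set.empty_subset]
    · intro x hx
      obtain ⟨k, hk, hsub⟩ := α.exists_basicBall A.isClosed.isOpen_compl hx
      refine Set.mem_iUnion.mpr ⟨k, ?_⟩
      simpa only [if_pos hsub] using hk

end DenseSequence

/-- The exact negative projection operator `X × 𝒜₋(X) ⇉ X`: a point `x` (with its Cauchy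
representation) and a nonempty closed set `A` (with negative information) are mapped to the points
`y ∈ A` with `d(x, y) = d(x, A)`. -/
def projNeg {X : Type} [MetricSpace X] (α : DenseSequence X) : Problem where
  Input := X × Closeds X
  Output := X
  inRep := α.cauchyRep.prod α.negRep
  outRep := α.cauchyRep
  sol z := {y | y ∈ z.2 ∧ dist z.1 y = Metric.infDist z.1 (z.2 : Set X)}

/-- The Bolzano-Weierstrass operator `X^ℕ ⇉ X`: a sequence whose range is relatively compact is
mapped to its accumulation (cluster) points. -/
def BWT {X : Type} [MetricSpace X] (α : DenseSequence X) : Problem where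
  Input := ℕ → X
  Output := X
  inRep := α.cauchyRep.seq
  outRep := α.cauchyRep
  sol s := {y | IsCompact (closure (Set.range s)) ∧ MapClusterPt y atTop s}

/-! ### The computable metric spaces `ℝ` and `ℝⁿ` -/

/-- `ℝ` with the enumeration of `ℚ`. -/
def realSeq : DenseSequence ℝ where
  pt k := (ratEnum k : ℝ)
  dense := by
    have h : Function.Surjective ratEnum := ratEnum_surj
    exact Rat.denseRange_cast.comp h.denseRange Rat.continuous_coe_real

/-- The `i`-th entry of the sequence coded by `k = ⟨k₀, ⟨k₁, ⟨k₂, …⟩⟩⟩`. -/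
def tupleEntry (k : ℕ) : ℕ → ℕ
  | 0 => k.unpair.1
  | i + 1 => tupleEntry k.unpair.2 i

theorem tupleEntry_surj (n : ℕ) (f : ℕ → ℕ) : ∃ k, ∀ i < n, tupleEntry k i = f i := by
  induction n generalizing f with
  | zero => exact ⟨0, fun i hi => absurd hi (Nat.not_lt_zero i)⟩
  | succ n ih =>
    obtain ⟨k, hk⟩ := ih fun i => f (i + 1)
    refine ⟨Nat.pair (f 0) k, fun i hi => ?_⟩
    cases i with
    | zero => simp [tupleEntry]
    | succ i => simpa [tupleEntry] using hk i (by omega)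

/-- `ℝⁿ` with the Euclidean metric and the enumeration of `ℚⁿ` induced by that of `ℚ`. -/
def euclideanSeq (n : ℕ) : DenseSequence (EuclideanSpace ℝ (Fin n)) where
  pt k := WithLp.toLp 2 fun i => (ratEnum (tupleEntry k i) : ℝ)
  dense := by
    have h1 : DenseRange (fun (q : Fin n → ℚ) (i : Fin n) => (q i : ℝ)) :=
      DenseRange.piMap fun _ => Rat.denseRange_cast
    have h2 : Function.Surjective
        (fun (k : ℕ) (i : Fin n) => ratEnum (tupleEntry k i)) := by
      intro q
      choose g hg using fun i : Fin n => ratEnum_surj (q i)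
      obtain ⟨k, hk⟩ := tupleEntry_surj n fun i => if h : i < n then g ⟨i, h⟩ else 0
      refine ⟨k, funext fun i => ?_⟩
      simp [hk i i.2, hg]
    have h3 : DenseRange (WithLp.toLp 2 : (Fin n → ℝ) → EuclideanSpace ℝ (Fin n)) :=
      (WithLp.toLp_surjective 2).denseRange
    have h4 := h1.comp h2.denseRange (by fun_prop)
    exact h3.comp h4 (PiLp.continuous_toLp 2 _)

end

/-!
**Accumulation points from projections.** For a bounded sequence of reals let `V` be the supremum of
the squares of the rational approximations occurring in its name, so that `c² ≤ V` for every
accumulation point `c`. A test consists of a rational interval and an index `N`, and is visited when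
some term with index at least `N` is seen to lie in the interval. Let `f c` be the sum, with weights
`1/2, 1/4, …`, of the tents over the intervals of the tests not visited and of the constant `1` for
the visited ones. Both `V` and `f` can be approximated from below, `f` is 1-Lipschitz, and `f` is
minimal exactly at the accumulation points, because every test around such a point is visited. Hence
the closed set `A = {z | V + f (z 0) ≤ ‖z‖²}` can be described negatively. A point of `A` nearest to
the origin has a first coordinate at which `f` is minimal: as `n ≥ 2`, every norm `w` with `c² ≤ w²`
is attained by a point with first coordinate `c`.

**Projections from accumulation points.** Fix a computable curve whose parameters are real and whose
image is `ℝⁿ`. At stage `k` choose, on a finite grid of parameters which becomes finer with `k`, a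
point of the curve closest to `x` among those which lie outside the first `k` removed balls, up to
an error that tends to zero with `k`, and whose parameter is not too large compared with their norm.
The chosen parameters are then bounded, and at each of their accumulation points the curve passes
through a point of `A` nearest to `x`.
-/

/-! ### Functionals that read a computable amount of input -/

/-- The word formed by the first `k` symbols of a sequence. -/
def initialWord (p : ℕ → ℕ) (k : ℕ) : List ℕ := (List.range k).map p

/-- The sequence that starts with the word `w` and continues with zeros; it lets functionals on
sequences be evaluated on words. -/
def zeroExtend (w : List ℕ) (e : ℕ) : ℕ := w.getD e 0

theorem primrec₂_zeroExtend : Primrec₂ zeroExtend := Primrec.list_getD 0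

theorem length_initialWord (p : ℕ → ℕ) (k : ℕ) : (initialWord p k).length = k := by
  simp [initialWord]

theorem initialWord_succ (p : ℕ → ℕ) (k : ℕ) :
    initialWord p (k + 1) = initialWord p k ++ [p k] := by
  simp [initialWord, List.range_succ]

theorem getElem?_initialWord (p : ℕ → ℕ) {k e : ℕ} (h : e < k) :
    (initialWord p k)[e]? = some (p e) := by
  simp [initialWord, h]

theorem zeroExtend_initialWord (p : ℕ → ℕ) {k e : ℕ} (h : e < k) :
    zeroExtend (initialWord p k) e = p e := by
  simp [zeroExtend, List.getD, getElem?_initialWord p h]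

/-- The symbol `F p m` depends only on the first `len m (p 0)` symbols of `p`. -/
def IsReadingBound (len : ℕ → ℕ → ℕ) (F : (ℕ → ℕ) → ℕ → ℕ) : Prop :=
  ∀ p p' m, (∀ e < len m (p 0), p e = p' e) → F p m = F p' m

/-- The machine that stores everything it has read and, after each symbol, writes the next value of
`F` provided that it has read as much as `len` demands. -/
def prefixMachine {len : ℕ → ℕ → ℕ} {F : (ℕ → ℕ) → ℕ → ℕ} (hlen : Primrec₂ len)
    (hF : Primrec₂ fun w m => F (zeroExtend w) m) : TypeTwoMachine where
  State := List ℕ × ℕ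
  init := ([], 0)
  step s a :=
    if len s.2 (zeroExtend (s.1 ++ [a]) 0) ≤ (s.1 ++ [a]).length then
      ((s.1 ++ [a], s.2 + 1), [F (zeroExtend (s.1 ++ [a])) s.2])
    else ((s.1 ++ [a], s.2), [])
  computable_step := by
    have hword : Primrec fun x : (List ℕ × ℕ) × ℕ => x.1.1 ++ [x.2] :=
      Primrec.list_concat.comp (Primrec.fst.comp Primrec.fst) Primrec.snd
    have hcount : Primrec fun x : (List ℕ × ℕ) × ℕ => x.1.2 := Primrec.snd.comp Primrec.fst
    refine (Primrec.ite (Primrec.nat_le.comp ?_ (Primrec.list_length.comp hword)) ?_ ?_).to_comp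
    · exact hlen.comp hcount (primrec₂_zeroExtend.comp hword (Primrec.const 0))
    · exact (hword.pair (Primrec.succ.comp hcount)).pair
        (Primrec.list_cons.comp (hF.comp hword hcount) (Primrec.const []))
    · exact (hword.pair hcount).pair (Primrec.const [])

/-- The number of symbols that `prefixMachine` has written after reading `k` symbols of `p`. -/
def writtenCount (len : ℕ → ℕ → ℕ) (p : ℕ → ℕ) : ℕ → ℕ
  | 0 => 0
  | k + 1 => if len (writtenCount len p k) (p 0) ≤ k + 1 then writtenCount len p k + 1
    else writtenCount len p k

section PrefixMachine

variable {len : ℕ → ℕ → ℕ} {F : (ℕ → ℕ) → ℕ → ℕ}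

theorem monotone_writtenCount (len : ℕ → ℕ → ℕ) (p : ℕ → ℕ) : Monotone (writtenCount len p) :=
  monotone_nat_of_le_succ fun k => by
    rw [writtenCount]
    split_ifs <;> omega

theorem exists_le_writtenCount (len : ℕ → ℕ → ℕ) (p : ℕ → ℕ) (m : ℕ) :
    ∃ k, m ≤ writtenCount len p k := by
  induction m with
  | zero => exact ⟨0, le_rfl⟩
  | succ m ih =>
    obtain ⟨k, hk⟩ := ih
    by_contra! hlt
    let k' := max k (len m (p 0))
    have hcount : writtenCount len p k' = m :=
      le_antisymm (Nat.lt_succ_iff.mp (hlt k'))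
        (hk.trans (monotone_writtenCount len p (le_max_left _ _)))
    have hread : len m (p 0) ≤ k' + 1 := (le_max_right _ _).trans (Nat.le_succ _)
    have hnext := hlt (k' + 1)
    rw [writtenCount, hcount, if_pos hread] at hnext
    exact hnext.false

theorem prefixMachine_config (hlen : Primrec₂ len) (hF : Primrec₂ fun w m => F (zeroExtend w) m)
    (hread : IsReadingBound len F) (p : ℕ → ℕ) (k : ℕ) :
    (prefixMachine hlen hF).config p k =
      ((initialWord p k, writtenCount len p k), initialWord (F p) (writtenCount len p k)) := by
  induction k with
  | zero => rfl
  | succ k ih =>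
    rw [TypeTwoMachine.config, ih]
    simp only [prefixMachine, writtenCount, ← initialWord_succ, length_initialWord,
      zeroExtend_initialWord p k.succ_pos]
    split_ifs with h
    · have hval : F (zeroExtend (initialWord p (k + 1))) (writtenCount len p k) =
          F p (writtenCount len p k) :=
        (hread _ _ _ fun e he => (zeroExtend_initialWord p (he.trans_le h)).symm).symm
      rw [hval, ← initialWord_succ]
    · rw [List.append_nil]

theorem IsReadingBound.baireComputable_lift (hread : IsReadingBound len F) (hlen : Primrec₂ len)
    (hF : Primrec₂ fun w m => F (zeroExtend w) m) : BaireComputable (PFun.lift F) := by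
  refine ⟨prefixMachine hlen hF, fun p q hq m => ?_⟩
  obtain rfl : q = F p := Part.mem_some_iff.mp hq
  obtain ⟨k, hk⟩ := exists_le_writtenCount len p (m + 1)
  exact ⟨k, by rw [prefixMachine_config hlen hF hread, getElem?_initialWord (F p) hk]⟩

end PrefixMachine

theorem StrongWeihrauchReducible.of_lift {f g : Problem} {H K : (ℕ → ℕ) → (ℕ → ℕ)}
    (hH : BaireComputable (PFun.lift H)) (hK : BaireComputable (PFun.lift K))
    (h : ∀ p x, f.inRep.IsName p x → (f.sol x).Nonempty →
      ∃ x', g.inRep.IsName (H p) x' ∧ (g.sol x').Nonempty ∧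
        ∀ q y', y' ∈ g.sol x' → g.outRep.IsName q y' → ∃ y ∈ f.sol x, f.outRep.IsName (K q) y) :
    StrongWeihrauchReducible f g := by
  refine ⟨_, _, hH, hK, fun G hG p x hp hx => ?_⟩
  obtain ⟨x', hname, hsol, hback⟩ := h p x hp hx
  obtain ⟨q, hq, y', hy', hname'⟩ := hG _ _ hname hsol
  refine ⟨K q, ?_, hback q y' hy' hname'⟩
  rw [PFun.comp_apply, PFun.comp_apply]
  exact Part.mem_bind (Part.mem_bind (Part.mem_some _) hq) (Part.mem_some _)

/-! ### Cauchy names -/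

namespace DenseSequence

variable {X : Type*} [MetricSpace X] (α : DenseSequence X)

theorem dist_le_of_isName {p : ℕ → ℕ} {x : X} (h : α.cauchyRep.IsName p x) (i : ℕ) :
    dist (α.pt (p i)) x ≤ (2 : ℝ)⁻¹ ^ i :=
  le_of_tendsto (tendsto_const_nhds.dist h.2)
    ((eventually_ge_atTop i).mono fun j hj => h.1 i j hj)

theorem isName_of_dist_le {p : ℕ → ℕ} {x : X}
    (h : ∀ i, dist (α.pt (p i)) x ≤ (2 : ℝ)⁻¹ ^ (i + 1)) : α.cauchyRep.IsName p x := by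
  refine ⟨fun i j hij => ?_, ?_⟩
  · have htri := dist_triangle_right (α.pt (p i)) (α.pt (p j)) x
    have hpow : (2 : ℝ)⁻¹ ^ (j + 1) ≤ (2 : ℝ)⁻¹ ^ (i + 1) :=
      pow_le_pow_of_le_one (by norm_num) (by norm_num) (by omega)
    have hsum : (2 : ℝ)⁻¹ ^ (i + 1) + (2 : ℝ)⁻¹ ^ (i + 1) = (2 : ℝ)⁻¹ ^ i := by
      rw [pow_succ]; ring
    linarith [h i, h j]
  · rw [tendsto_iff_dist_tendsto_zero]
    exact squeeze_zero (fun _ => dist_nonneg) h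
      ((tendsto_pow_atTop_nhds_zero_of_lt_one (by norm_num) (by norm_num)).comp
        (tendsto_add_atTop_nat 1))

end DenseSequence

/-! ### Primitive recursive rational-valued functions -/

section PrimrecRat

variable {α β : Type*} [Primcodable α] [Primcodable β]

theorem primrecPred_imp {p q : α → Prop} (hp : PrimrecPred p) (hq : PrimrecPred q) :
    PrimrecPred fun x => p x → q x :=
  (hp.not.or hq).of_eq fun _ => imp_iff_not_or.symm

theorem primrecPred_exists_lt {R : α → ℕ → Prop} (hR : PrimrecPred fun y : α × ℕ => R y.1 y.2)
    {N : α → ℕ} (hN : Primrec N) : PrimrecPred fun x => ∃ j < N x, R x j :=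
  ((PrimrecRel.exists_mem_list (R := fun j x => R x j) hR.primrecRel.swap).comp
    (Primrec.list_range.comp hN) Primrec.id).of_eq fun x => by simp

theorem primrecPred_forall_lt {R : α → ℕ → Prop} (hR : PrimrecPred fun y : α × ℕ => R y.1 y.2)
    {N : α → ℕ} (hN : Primrec N) : PrimrecPred fun x => ∀ j < N x, R x j :=
  ((PrimrecRel.forall_mem_list (R := fun j x => R x j) hR.primrecRel.swap).comp
    (Primrec.list_range.comp hN) Primrec.id).of_eq fun x => by simp

theorem primrec_unpair_fst {f : α → ℕ} (hf : Primrec f) : Primrec fun x => (f x).unpair.1 :=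
  Primrec.fst.comp (Primrec.unpair.comp hf)

theorem primrec_unpair_snd {f : α → ℕ} (hf : Primrec f) : Primrec fun x => (f x).unpair.2 :=
  Primrec.snd.comp (Primrec.unpair.comp hf)

theorem primrec_nat_pow {f g : α → ℕ} (hf : Primrec f) (hg : Primrec g) :
    Primrec fun x => f x ^ g x :=
  (Primrec₂.unpaired'.1 Nat.Primrec.pow).comp hf hg

theorem primrec_tupleEntry : Primrec₂ tupleEntry := by
  have h : Primrec₂ fun k i : ℕ => ((fun a : ℕ => a.unpair.2)^[i] k).unpair.1 :=
    primrec_unpair_fst (Primrec.nat_iterate Primrec.snd Primrec.fst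
      (primrec_unpair_snd Primrec.snd).to₂)
  refine h.of_eq fun k i => ?_
  induction i generalizing k with
  | zero => rfl
  | succ i ih => rw [Function.iterate_succ_apply, ih]; rfl

theorem exists_primrec_tupleCode (n : ℕ) {f : α → ℕ → ℕ} (hf : Primrec₂ f) :
    ∃ c : α → ℕ, Primrec c ∧ ∀ x, ∀ i < n, tupleEntry (c x) i = f x i := by
  induction n generalizing f with
  | zero => exact ⟨fun _ => 0, Primrec.const 0, fun x i hi => absurd hi (Nat.not_lt_zero i)⟩
  | succ n ih =>
    obtain ⟨c, hc, h⟩ := ih (f := fun x i => f x (i + 1))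
      (hf.comp₂ Primrec₂.left (Primrec.succ.comp₂ Primrec₂.right))
    refine ⟨fun x => Nat.pair (f x 0) (c x),
      Primrec₂.natPair.comp (hf.comp Primrec.id (Primrec.const 0)) hc, fun x i hi => ?_⟩
    cases i with
    | zero => simp [tupleEntry]
    | succ i => simpa [tupleEntry] using h x i (by omega)

/-- `f` has a primitive recursive choice of codes with respect to `ratEnum`. -/
def PrimrecRat (f : α → ℚ) : Prop := ∃ m : α → ℕ, Primrec m ∧ ∀ x, ratEnum (m x) = f x

namespace PrimrecRat

theorem of_fraction {f : α → ℚ} {a b c : α → ℕ} (ha : Primrec a) (hb : Primrec b)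
    (hc : Primrec c) (h : ∀ x, f x = ((a x : ℚ) - b x) / ((c x : ℚ) + 1)) : PrimrecRat f :=
  ⟨fun x => Nat.pair (Nat.pair (a x) (b x)) (c x),
    Primrec₂.natPair.comp (Primrec₂.natPair.comp ha hb) hc, fun x => by simp [ratEnum, h x]⟩

theorem exists_fraction {f : α → ℚ} (hf : PrimrecRat f) : ∃ a b c : α → ℕ, Primrec a ∧ Primrec b ∧
    Primrec c ∧ ∀ x, f x = ((a x : ℚ) - b x) / ((c x : ℚ) + 1) := by
  obtain ⟨m, hm, h⟩ := hf
  have hnum := primrec_unpair_fst hm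
  exact ⟨_, _, _, primrec_unpair_fst hnum, primrec_unpair_snd hnum, primrec_unpair_snd hm,
    fun x => (h x).symm⟩

theorem of_eq {f g : α → ℚ} (hf : PrimrecRat f) (h : ∀ x, f x = g x) : PrimrecRat g :=
  (funext h : f = g) ▸ hf

theorem comp {f : β → ℚ} (hf : PrimrecRat f) {g : α → β} (hg : Primrec g) :
    PrimrecRat fun x => f (g x) :=
  let ⟨m, hm, h⟩ := hf
  ⟨fun x => m (g x), hm.comp hg, fun _ => h _⟩

theorem ratEnum : PrimrecRat ratEnum := ⟨id, Primrec.id, fun _ => rfl⟩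

theorem natCast {f : α → ℕ} (hf : Primrec f) : PrimrecRat fun x => (f x : ℚ) :=
  of_fraction hf (Primrec.const 0) (Primrec.const 0) fun x => by simp

theorem const (q : ℚ) : PrimrecRat fun _ : α => q :=
  let ⟨m, hm⟩ := ratEnum_surj q
  ⟨fun _ => m, Primrec.const m, fun _ => hm⟩

theorem natCast_div {f g : α → ℕ} (hf : Primrec f) (hg : Primrec g) :
    PrimrecRat fun x => (f x : ℚ) / ((g x : ℚ) + 1) :=
  of_fraction hf (Primrec.const 0) hg fun x => by simp

theorem nnratEnum : PrimrecRat nnratEnum :=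
  natCast_div (primrec_unpair_fst Primrec.id) (primrec_unpair_snd Primrec.id)

theorem inv_natCast_pow (b : ℕ) (hb : 0 < b) {f : α → ℕ} (hf : Primrec f) :
    PrimrecRat fun x => ((b : ℚ) ^ f x)⁻¹ :=
  (natCast_div (Primrec.const 1)
    (Primrec.pred.comp (primrec_nat_pow (Primrec.const b) hf))).of_eq fun x => by
    have hden : ((Nat.pred (b ^ f x) : ℕ) : ℚ) + 1 = (b : ℚ) ^ f x := by
      exact_mod_cast Nat.succ_pred_eq_of_pos (pow_pos hb (f x))
    rw [hden, Nat.cast_one, one_div]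

theorem neg {f : α → ℚ} (hf : PrimrecRat f) : PrimrecRat fun x => -f x := by
  obtain ⟨a, b, c, ha, hb, hc, h⟩ := hf.exists_fraction
  exact of_fraction hb ha hc fun x => by rw [h]; ring

theorem add {f g : α → ℚ} (hf : PrimrecRat f) (hg : PrimrecRat g) :
    PrimrecRat fun x => f x + g x := by
  obtain ⟨a, b, c, ha, hb, hc, h⟩ := hf.exists_fraction
  obtain ⟨a', b', c', ha', hb', hc', h'⟩ := hg.exists_fraction
  have hs := Primrec.succ.comp hc
  have hs' := Primrec.succ.comp hc'
  refine of_fraction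
    (a := fun x => a x * (c' x).succ + a' x * (c x).succ)
    (b := fun x => b x * (c' x).succ + b' x * (c x).succ)
    (c := fun x => c x * c' x + c x + c' x)
    (Primrec.nat_add.comp (Primrec.nat_mul.comp ha hs') (Primrec.nat_mul.comp ha' hs))
    (Primrec.nat_add.comp (Primrec.nat_mul.comp hb hs') (Primrec.nat_mul.comp hb' hs))
    (Primrec.nat_add.comp (Primrec.nat_add.comp (Primrec.nat_mul.comp hc hc') hc) hc')
    fun x => ?_
  have hden : (c x : ℚ) * c' x + c x + c' x + 1 = (c x + 1) * (c' x + 1) := by ring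
  rw [h, h']
  push_cast
  rw [hden]
  field_simp
  ring

theorem mul {f g : α → ℚ} (hf : PrimrecRat f) (hg : PrimrecRat g) :
    PrimrecRat fun x => f x * g x := by
  obtain ⟨a, b, c, ha, hb, hc, h⟩ := hf.exists_fraction
  obtain ⟨a', b', c', ha', hb', hc', h'⟩ := hg.exists_fraction
  refine of_fraction
    (a := fun x => a x * a' x + b x * b' x)
    (b := fun x => a x * b' x + b x * a' x)
    (c := fun x => c x * c' x + c x + c' x)
    (Primrec.nat_add.comp (Primrec.nat_mul.comp ha ha') (Primrec.nat_mul.comp hb hb'))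
    (Primrec.nat_add.comp (Primrec.nat_mul.comp ha hb') (Primrec.nat_mul.comp hb ha'))
    (Primrec.nat_add.comp (Primrec.nat_add.comp (Primrec.nat_mul.comp hc hc') hc) hc')
    fun x => ?_
  have hden : (c x : ℚ) * c' x + c x + c' x + 1 = (c x + 1) * (c' x + 1) := by ring
  rw [h, h']
  push_cast
  rw [hden]
  field_simp
  ring

theorem sub {f g : α → ℚ} (hf : PrimrecRat f) (hg : PrimrecRat g) :
    PrimrecRat fun x => f x - g x :=
  (hf.add hg.neg).of_eq fun _ => (sub_eq_add_neg _ _).symm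

theorem sq {f : α → ℚ} (hf : PrimrecRat f) : PrimrecRat fun x => f x ^ 2 :=
  (hf.mul hf).of_eq fun _ => (pow_two _).symm

theorem nonneg {f : α → ℚ} (hf : PrimrecRat f) : PrimrecPred fun x => 0 ≤ f x := by
  obtain ⟨a, b, c, ha, hb, -, h⟩ := hf.exists_fraction
  refine (Primrec.nat_le.comp hb ha).of_eq fun x => ?_
  have hden : (0 : ℚ) < (c x : ℚ) + 1 := by positivity
  rw [h, le_div_iff₀ hden, zero_mul, sub_nonneg, Nat.cast_le]

theorem le {f g : α → ℚ} (hf : PrimrecRat f) (hg : PrimrecRat g) :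
    PrimrecPred fun x => f x ≤ g x :=
  (hg.sub hf).nonneg.of_eq fun _ => sub_nonneg

theorem lt {f g : α → ℚ} (hf : PrimrecRat f) (hg : PrimrecRat g) :
    PrimrecPred fun x => f x < g x :=
  (hg.le hf).not.of_eq fun _ => not_le

theorem ite {c : α → Prop} [DecidablePred c] {f g : α → ℚ} (hc : PrimrecPred c)
    (hf : PrimrecRat f) (hg : PrimrecRat g) : PrimrecRat fun x => if c x then f x else g x := by
  obtain ⟨m, hm, h⟩ := hf
  obtain ⟨m', hm', h'⟩ := hg
  refine ⟨fun x => if c x then m x else m' x, Primrec.ite hc hm hm', fun x => ?_⟩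
  by_cases hx : c x <;> simp [hx, h, h']

theorem max {f g : α → ℚ} (hf : PrimrecRat f) (hg : PrimrecRat g) :
    PrimrecRat fun x => max (f x) (g x) :=
  (ite (hf.le hg) hg hf).of_eq fun _ => (max_def _ _).symm

theorem min {f g : α → ℚ} (hf : PrimrecRat f) (hg : PrimrecRat g) :
    PrimrecRat fun x => min (f x) (g x) :=
  (ite (hf.le hg) hf hg).of_eq fun _ => (min_def _ _).symm

theorem abs {f : α → ℚ} (hf : PrimrecRat f) : PrimrecRat fun x => |f x| :=
  hf.max hf.neg

theorem fract {f : α → ℚ} (hf : PrimrecRat f) : PrimrecRat fun x => Int.fract (f x) := by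
  obtain ⟨a, b, c, ha, hb, hc, h⟩ := hf.exists_fraction
  refine (natCast_div (Primrec.nat_mod.comp
    (Primrec.nat_add.comp ha (Primrec.nat_mul.comp hb hc)) (Primrec.succ.comp hc)) hc).of_eq
    fun x => ?_
  -- Adding the integer `b` to `(a - b) / (c + 1)` makes the numerator a natural number.
  have hshift : f x = ((a x + b x * c x : ℕ) : ℚ) / ((c x + 1 : ℕ) : ℚ) - (b x : ℕ) := by
    rw [h]; push_cast; field_simp; ring
  rw [hshift, Int.fract_sub_natCast, Int.fract_div_natCast_eq_div_natCast_mod]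
  push_cast
  rfl

theorem sum_range {f : α → ℕ → ℚ} (hf : PrimrecRat fun x : α × ℕ => f x.1 x.2) {N : α → ℕ}
    (hN : Primrec N) : PrimrecRat fun x => ∑ j ∈ Finset.range (N x), f x j := by
  obtain ⟨m, hm, h⟩ := hf
  obtain ⟨s, hs, hadd⟩ : PrimrecRat fun x : ℕ × ℕ => _root_.ratEnum x.1 + _root_.ratEnum x.2 :=
    (ratEnum.comp Primrec.fst).add (ratEnum.comp Primrec.snd)
  have hrec : Primrec fun x : α =>
      Nat.rec (motive := fun _ => ℕ) 0 (fun j r => s (r, m (x, j))) (N x) := by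
    refine Primrec.nat_rec' hN (Primrec.const 0)
      (h := fun x jr => s (jr.2, m (x, jr.1))) ?_
    exact hs.comp ((Primrec.snd.comp Primrec.snd).pair
      (hm.comp (Primrec.fst.pair (Primrec.fst.comp Primrec.snd))))
  refine ⟨_, hrec, fun x => ?_⟩
  beta_reduce
  generalize N x = k
  induction k with
  | zero => simp [_root_.ratEnum]
  | succ k ih => rw [Finset.sum_range_succ, ← ih, hadd]; simp only [h]

end PrimrecRat

end PrimrecRat

/-! ### Dyadically weighted sums -/

/-- The sum of the first `m` terms of `u` with the weights `1/2, 1/4, 1/8, …`.  It is used both for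
rational approximations and for their real limits. -/
def dyadicSum {k : Type*} [Field k] (u : ℕ → k) (m : ℕ) : k :=
  ∑ j ∈ Finset.range m, (2 ^ (j + 1))⁻¹ * u j

/-- The series with terms `u` and weights `1/2, 1/4, 1/8, …`. -/
noncomputable def dyadicSeries (u : ℕ → ℝ) : ℝ := ∑' j, (2 ^ (j + 1))⁻¹ * u j

section DyadicSum

variable {k : Type*} [Field k]

theorem dyadicSum_succ (u : ℕ → k) (m : ℕ) :
    dyadicSum u (m + 1) = dyadicSum u m + (2 ^ (m + 1))⁻¹ * u m :=
  Finset.sum_range_succ _ _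

@[simp, norm_cast]
theorem ratCast_dyadicSum [CharZero k] (u : ℕ → ℚ) (m : ℕ) :
    ((dyadicSum u m : ℚ) : k) = dyadicSum (fun j => (u j : k)) m := by
  simp [dyadicSum]

theorem primrecRat_dyadicSum {α : Type*} [Primcodable α] {u : α → ℕ → ℚ}
    (hu : PrimrecRat fun x : α × ℕ => u x.1 x.2) {m : α → ℕ} (hm : Primrec m) :
    PrimrecRat fun x => dyadicSum (u x) (m x) :=
  PrimrecRat.sum_range
    (((PrimrecRat.inv_natCast_pow 2 two_pos (Primrec.succ.comp Primrec.snd)).of_eq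
      fun x => by simp).mul hu) hm

theorem dyadicSum_one_sub [CharZero k] (u : ℕ → k) (m : ℕ) :
    dyadicSum (fun j => 1 - u j) m = 1 - (2 ^ m)⁻¹ - dyadicSum u m := by
  induction m with
  | zero => simp [dyadicSum]
  | succ m ih =>
    rw [dyadicSum_succ, dyadicSum_succ, ih]
    field_simp
    ring

variable [LinearOrder k] [IsStrictOrderedRing k]

theorem monotone_dyadicSum {u : ℕ → k} (hu : ∀ j, 0 ≤ u j) : Monotone (dyadicSum u) :=
  monotone_nat_of_le_succ fun m => by
    rw [dyadicSum_succ]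
    exact le_add_of_nonneg_right (mul_nonneg (by positivity) (hu m))

theorem dyadicSum_le_dyadicSum {u v : ℕ → k} {m : ℕ} (h : ∀ j < m, u j ≤ v j) :
    dyadicSum u m ≤ dyadicSum v m :=
  Finset.sum_le_sum fun j hj =>
    mul_le_mul_of_nonneg_left (h j (Finset.mem_range.mp hj)) (by positivity)

theorem dyadicSum_nonneg {u : ℕ → k} (hu : ∀ j, 0 ≤ u j) (m : ℕ) : 0 ≤ dyadicSum u m :=
  Finset.sum_nonneg fun j _ => mul_nonneg (by positivity) (hu j)

theorem dyadicSum_le_one {u : ℕ → k} (hu : ∀ j, u j ≤ 1) (m : ℕ) : dyadicSum u m ≤ 1 := by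
  have hcompl := dyadicSum_nonneg (fun j => sub_nonneg.mpr (hu j)) m
  have hpow : (0 : k) < (2 ^ m)⁻¹ := by positivity
  rw [dyadicSum_one_sub] at hcompl
  linarith

theorem abs_dyadicSum_sub_le {u v : ℕ → k} {C : k} {m : ℕ} (hC : 0 ≤ C)
    (h : ∀ j < m, |u j - v j| ≤ C) : |dyadicSum u m - dyadicSum v m| ≤ C := by
  have hconst : dyadicSum (fun _ => C) m ≤ C := by
    have hone := dyadicSum_le_one (fun _ => le_refl (1 : k)) m
    calc dyadicSum (fun _ => C) m = dyadicSum (fun _ => 1) m * C := by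
          simp [dyadicSum, Finset.sum_mul]
      _ ≤ C := mul_le_of_le_one_left hC hone
  refine le_trans ?_ hconst
  rw [dyadicSum, dyadicSum, ← Finset.sum_sub_distrib]
  refine (Finset.abs_sum_le_sum_abs _ _).trans (Finset.sum_le_sum fun j hj => ?_)
  rw [← mul_sub, abs_mul, abs_of_pos (show (0 : k) < (2 ^ (j + 1))⁻¹ by positivity)]
  exact mul_le_mul_of_nonneg_left (h j (Finset.mem_range.mp hj)) (by positivity)

end DyadicSum

section DyadicSeries

variable {u v : ℕ → ℝ}

theorem summable_dyadicSeries (hu : ∀ j, u j ∈ Set.Icc 0 1) :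
    Summable fun j => (2 ^ (j + 1))⁻¹ * u j :=
  summable_of_sum_range_le (fun j => mul_nonneg (by positivity) (hu j).1)
    (dyadicSum_le_one fun j => (hu j).2)

theorem tendsto_dyadicSum (hu : ∀ j, u j ∈ Set.Icc 0 1) :
    Tendsto (dyadicSum u) atTop (𝓝 (dyadicSeries u)) :=
  (summable_dyadicSeries hu).hasSum.tendsto_sum_nat

theorem dyadicSum_le_dyadicSeries (hu : ∀ j, u j ∈ Set.Icc 0 1) (m : ℕ) :
    dyadicSum u m ≤ dyadicSeries u :=
  (monotone_dyadicSum fun j => (hu j).1).ge_of_tendsto (tendsto_dyadicSum hu) m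

theorem dyadicSeries_le_dyadicSum_add (hu : ∀ j, u j ∈ Set.Icc 0 1) (m : ℕ) :
    dyadicSeries u ≤ dyadicSum u m + (2 ^ m)⁻¹ := by
  refine le_of_tendsto (tendsto_dyadicSum hu) ((eventually_ge_atTop m).mono fun m' hm => ?_)
  have hcompl := monotone_dyadicSum (fun j => sub_nonneg.mpr (hu j).2) hm
  have hpow : (0 : ℝ) < (2 ^ m')⁻¹ := by positivity
  rw [dyadicSum_one_sub, dyadicSum_one_sub] at hcompl
  linarith

theorem continuous_dyadicSeries {X : Type*} [TopologicalSpace X] {u : X → ℕ → ℝ}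
    (hcont : ∀ j, Continuous fun x => u x j) (hu : ∀ x j, u x j ∈ Set.Icc 0 1) :
    Continuous fun x => dyadicSeries (u x) := by
  refine continuous_tsum (fun j => (hcont j).const_mul _)
    (summable_dyadicSeries fun _ => Set.right_mem_Icc.mpr zero_le_one) fun j x => ?_
  rw [Real.norm_of_nonneg (mul_nonneg (by positivity) (hu x j).1)]
  exact mul_le_mul_of_nonneg_left (hu x j).2 (by positivity)

theorem dyadicSeries_lt_dyadicSeries (hu : ∀ j, u j ∈ Set.Icc 0 1) (hv : ∀ j, v j ∈ Set.Icc 0 1)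
    (hle : ∀ j, u j ≤ v j) {j : ℕ} (hlt : u j < v j) : dyadicSeries u < dyadicSeries v :=
  Summable.tsum_lt_tsum (fun j => mul_le_mul_of_nonneg_left (hle j) (by positivity))
    (mul_lt_mul_of_pos_left hlt (by positivity)) (summable_dyadicSeries hu)
    (summable_dyadicSeries hv)

end DyadicSeries

/-! ### Rational points and basic balls -/

theorem abs_ratEnum_le (k : ℕ) : |ratEnum k| ≤ k := by
  have hden : (0 : ℚ) < (k.unpair.2 : ℚ) + 1 := by positivity
  have hpos : ((k.unpair.1.unpair.1 : ℕ) : ℚ) ≤ k := by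
    exact_mod_cast (Nat.unpair_left_le _).trans (Nat.unpair_left_le _)
  have hneg : ((k.unpair.1.unpair.2 : ℕ) : ℚ) ≤ k := by
    exact_mod_cast (Nat.unpair_right_le _).trans (Nat.unpair_left_le _)
  have hprod : (0 : ℚ) ≤ k * k.unpair.2 := by positivity
  rw [ratEnum, abs_div, abs_of_pos hden, div_le_iff₀ hden, abs_le]
  constructor <;> linarith [k.unpair.1.unpair.1.cast_nonneg (α := ℚ),
    k.unpair.1.unpair.2.cast_nonneg (α := ℚ)]

theorem tupleEntry_zero (i : ℕ) : tupleEntry 0 i = 0 := by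
  induction i with
  | zero => simp [tupleEntry]
  | succ i ih => simpa [tupleEntry] using ih

theorem euclideanSeq_pt_apply (n k : ℕ) (i : Fin n) :
    (euclideanSeq n).pt k i = (ratEnum (tupleEntry k i) : ℝ) := rfl

theorem euclideanSeq_pt_zero (n : ℕ) : (euclideanSeq n).pt 0 = 0 := by
  ext i
  simp [euclideanSeq_pt_apply, tupleEntry_zero, ratEnum]

/-- Squared norm of the `k`-th rational point. -/
def normSqEnum (n k : ℕ) : ℚ := ∑ i ∈ Finset.range n, ratEnum (tupleEntry k i) ^ 2

theorem primrecRat_normSqEnum (n : ℕ) : PrimrecRat (normSqEnum n) :=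
  PrimrecRat.sum_range (f := fun k i => ratEnum (tupleEntry k i) ^ 2)
    (PrimrecRat.ratEnum.comp primrec_tupleEntry).sq (Primrec.const n)

theorem ratCast_normSqEnum (n k : ℕ) : (normSqEnum n k : ℝ) = ‖(euclideanSeq n).pt k‖ ^ 2 := by
  rw [EuclideanSpace.norm_sq_eq, normSqEnum, Finset.sum_range]
  push_cast
  simp only [euclideanSeq_pt_apply, Real.norm_eq_abs, sq_abs]

namespace DenseSequence

variable {X : Type*} [MetricSpace X] (α : DenseSequence X)

theorem basicBall_zero : α.basicBall 0 = ∅ := by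
  simp [basicBall, nnratEnum]

theorem exists_mem_basicBall_of_eventually {x : X} {P : X × ℝ → Prop} (h : ∀ᶠ y in 𝓝 (x, 0), P y) :
    ∃ b, x ∈ α.basicBall b ∧ P (α.pt b.unpair.1, nnratEnum b.unpair.2) := by
  obtain ⟨ε, hε, hP⟩ := Metric.eventually_nhds_iff.mp h
  obtain ⟨r, hr0, hrε⟩ := exists_rat_btwn hε
  obtain ⟨k, hk⟩ := α.dense.exists_dist_lt x hr0
  obtain ⟨l, hl⟩ := nnratEnum_surj r (by exact_mod_cast hr0.le)
  refine ⟨Nat.pair k l, ?_, hP ?_⟩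
  · simpa [basicBall, hl] using hk
  · have hr : |(r : ℝ)| < ε := by rwa [abs_of_pos hr0]
    rw [Prod.dist_eq, max_lt_iff]
    rw [Nat.unpair_pair, hl, dist_comm, Real.dist_0_eq_abs]
    exact ⟨hk.trans hrε, hr⟩

end DenseSequence

/-! ### Certifying that a ball lies below `v + f` -/

section NormSqCertificate

variable {E : Type*} [SeminormedAddCommGroup E] {f : E → ℝ} {v : ℝ}

/-- A sufficient condition for `‖z‖² < v + f z` on the ball of radius `r` around `c`, for
1-Lipschitz `f`.  It rests on `‖z‖² ≤ ‖c‖² + (‖c‖² + 2) d` for `d = ‖z - c‖ ≤ 1`; the third `d`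
pays for replacing `f c` by `f z`. -/
def NormSqCertificate (f : E → ℝ) (v : ℝ) (c : E) (r : ℝ) : Prop :=
  r ≤ 1 ∧ ‖c‖ ^ 2 + (‖c‖ ^ 2 + 3) * r ≤ v + f c

theorem NormSqCertificate.norm_sq_lt {c z : E} {r : ℝ} (h : NormSqCertificate f v c r)
    (hf : LipschitzWith 1 f) (hz : z ∈ Metric.ball c r) : ‖z‖ ^ 2 < v + f z := by
  obtain ⟨hr, hc⟩ := h
  have hd : dist z c < r := hz
  have hd0 : 0 ≤ dist z c := dist_nonneg
  have hlip : f c ≤ f z + dist z c := by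
    simpa [dist_comm] using hf.le_add_mul c z
  have hnorm : ‖z‖ ≤ ‖c‖ + dist z c := by
    rw [dist_eq_norm]
    exact norm_le_norm_add_norm_sub' z c
  have hsq : ‖z‖ ^ 2 ≤ (‖c‖ + dist z c) ^ 2 := pow_le_pow_left₀ (norm_nonneg z) hnorm 2
  have hcross : 0 ≤ (‖c‖ - 1) ^ 2 * dist z c := mul_nonneg (sq_nonneg _) hd0
  have hdd : dist z c * dist z c ≤ dist z c * 1 :=
    mul_le_mul_of_nonneg_left (hd.le.trans hr) hd0
  have hstrict : (‖c‖ ^ 2 + 3) * dist z c < (‖c‖ ^ 2 + 3) * r :=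
    mul_lt_mul_of_pos_left hd (by positivity)
  linarith

theorem eventually_normSqCertificate (hf : Continuous f) {z : E} (h : ‖z‖ ^ 2 < v + f z) :
    ∀ᶠ y : E × ℝ in 𝓝 (z, 0), NormSqCertificate f v y.1 y.2 := by
  have hradius : IsOpen {y : E × ℝ | y.2 < 1} := isOpen_lt continuous_snd continuous_const
  have hbound : IsOpen {y : E × ℝ | ‖y.1‖ ^ 2 + (‖y.1‖ ^ 2 + 3) * y.2 < v + f y.1} :=
    isOpen_lt (by fun_prop) (by fun_prop)
  filter_upwards [hradius.mem_nhds (by simp), hbound.mem_nhds (by simpa using h)] with y hr hy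
  exact ⟨le_of_lt hr, le_of_lt hy⟩

end NormSqCertificate

/-! ### Accumulation points from projections -/

/-- Centre of the `j`-th test interval. -/
def testCenter (j : ℕ) : ℚ := ratEnum j.unpair.1.unpair.1

/-- Radius of the `j`-th test interval. -/
def testRadius (j : ℕ) : ℚ := ((1 : ℕ) : ℚ) / ((j.unpair.1.unpair.2 : ℚ) + 1)

/-- The tests `j` which the first `m` symbols of a name `p` of a real sequence show to be visited:
some term with index at least `j.unpair.2` lies in the `j`-th test interval. -/
def visited (p : ℕ → ℕ) (m : ℕ) : Set ℕ :=
  {j | ∃ e < m, j.unpair.2 ≤ e.unpair.1 ∧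
    |ratEnum (p e) - testCenter j| + (((2 : ℕ) : ℚ) ^ e.unpair.2)⁻¹ < testRadius j}

/-- The tent function over the `j`-th test interval. -/
def tent {k : Type*} [Field k] [LinearOrder k] (j : ℕ) (c : k) : k :=
  max 0 ((testRadius j : k) - |c - (testCenter j : k)|)

open Classical in
/-- The `j`-th contribution to the penalty at `c`: a tent over the `j`-th test interval, replaced
by the constant `1` if `j` belongs to the set `V` of visited tests. -/
noncomputable def penaltyTerm {k : Type*} [Field k] [LinearOrder k] (V : Set ℕ) (c : k) (j : ℕ) :
    k :=
  if j ∈ V then 1 else tent j c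

/-- The penalty at `c` as far as it is known after `m` input symbols. -/
noncomputable def stagePenalty {k : Type*} [Field k] [LinearOrder k] (p : ℕ → ℕ) (m : ℕ) (c : k) :
    k :=
  dyadicSum (penaltyTerm (visited p m) c) m

/-- The penalty at `c`; it is minimal exactly at the accumulation points of the sequence. -/
noncomputable def limitPenalty (p : ℕ → ℕ) (c : ℝ) : ℝ :=
  dyadicSeries (penaltyTerm (⋃ m, visited p m) c)

/-- The first `m` symbols of `p` certify that the `b`-th basic ball lies in
`{z | ∃ e, ‖z‖² < (ratEnum (p e))² + limitPenalty p (z 0)}`. -/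
def Removable (n : ℕ) (p : ℕ → ℕ) (m b : ℕ) : Prop :=
  ∃ e < m, nnratEnum b.unpair.2 ≤ 1 ∧
    normSqEnum n b.unpair.1 + (normSqEnum n b.unpair.1 + 3) * nnratEnum b.unpair.2 ≤
      ratEnum (p e) ^ 2 + stagePenalty p m (ratEnum (tupleEntry b.unpair.1 0))

open Classical in
/-- Turns a name of a real sequence into a name of the origin (even places) paired with a closed
set, whose complement consists of the removable balls (odd places). -/
noncomputable def accumulationToProj (n : ℕ) (p : ℕ → ℕ) (m : ℕ) : ℕ :=
  if m % 2 = 1 ∧ Removable n p (m / 2) (m / 2).unpair.1 then (m / 2).unpair.1 else 0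

section Computability

theorem visited_congr {p p' : ℕ → ℕ} {m : ℕ} (h : ∀ e < m, p e = p' e) :
    visited p m = visited p' m := by
  ext j
  refine exists_congr fun e => and_congr_right fun he => ?_
  rw [h e he]

theorem removable_congr (n : ℕ) {p p' : ℕ → ℕ} {m : ℕ} (h : ∀ e < m, p e = p' e) (b : ℕ) :
    Removable n p m b ↔ Removable n p' m b := by
  refine exists_congr fun e => and_congr_right fun he => ?_
  rw [h e he, stagePenalty, stagePenalty, visited_congr h]

theorem isReadingBound_accumulationToProj (n : ℕ) :
    IsReadingBound (fun m _ => m) (accumulationToProj n) := by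
  intro p p' m h
  have hcongr := removable_congr n (fun e he => h e (he.trans_le (Nat.div_le_self m 2)))
    (m / 2).unpair.1
  rw [accumulationToProj, accumulationToProj, propext hcongr]

variable {α : Type*} [Primcodable α] {w : α → List ℕ} {m j b : α → ℕ}

theorem primrecRat_testCenter : PrimrecRat testCenter :=
  PrimrecRat.ratEnum.comp (primrec_unpair_fst (primrec_unpair_fst Primrec.id))

theorem primrecRat_testRadius : PrimrecRat testRadius :=
  PrimrecRat.natCast_div (Primrec.const 1) (primrec_unpair_snd (primrec_unpair_fst Primrec.id))

theorem primrecRat_tent {c : α → ℚ} (hj : Primrec j) (hc : PrimrecRat c) :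
    PrimrecRat fun x => tent (j x) (c x) :=
  ((PrimrecRat.const 0).max ((primrecRat_testRadius.comp hj).sub
    (hc.sub (primrecRat_testCenter.comp hj)).abs)).of_eq fun x => by simp [tent]

theorem primrecPred_mem_visited (hw : Primrec w) (hm : Primrec m) (hj : Primrec j) :
    PrimrecPred fun x => j x ∈ visited (zeroExtend (w x)) (m x) := by
  have hj' : Primrec fun y : α × ℕ => j y.1 := hj.comp Primrec.fst
  have happrox : PrimrecRat fun y : α × ℕ => ratEnum (zeroExtend (w y.1) y.2) :=
    PrimrecRat.ratEnum.comp (primrec₂_zeroExtend.comp (hw.comp Primrec.fst) Primrec.snd)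
  refine primrecPred_exists_lt (PrimrecPred.and ?_ ?_) hm
  · exact Primrec.nat_le.comp (primrec_unpair_snd hj') (primrec_unpair_fst Primrec.snd)
  · exact ((happrox.sub (primrecRat_testCenter.comp hj')).abs.add
      (PrimrecRat.inv_natCast_pow 2 two_pos (primrec_unpair_snd Primrec.snd))).lt
        (primrecRat_testRadius.comp hj')

theorem primrecRat_stagePenalty {c : α → ℚ} (hw : Primrec w) (hm : Primrec m)
    (hc : PrimrecRat c) : PrimrecRat fun x => stagePenalty (zeroExtend (w x)) (m x) (c x) := by
  classical
  refine primrecRat_dyadicSum (PrimrecRat.ite ?_ (PrimrecRat.const 1) ?_) hm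
  · exact primrecPred_mem_visited (hw.comp Primrec.fst) (hm.comp Primrec.fst) Primrec.snd
  · exact primrecRat_tent Primrec.snd (hc.comp Primrec.fst)

theorem primrecPred_removable (n : ℕ) (hw : Primrec w) (hm : Primrec m) (hb : Primrec b) :
    PrimrecPred fun x => Removable n (zeroExtend (w x)) (m x) (b x) := by
  have hcenter : Primrec fun y : α × ℕ => (b y.1).unpair.1 :=
    primrec_unpair_fst (hb.comp Primrec.fst)
  have hradius : PrimrecRat fun y : α × ℕ => nnratEnum (b y.1).unpair.2 :=
    PrimrecRat.nnratEnum.comp (primrec_unpair_snd (hb.comp Primrec.fst))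
  have hnorm := (primrecRat_normSqEnum n).comp hcenter
  have happrox : PrimrecRat fun y : α × ℕ => ratEnum (zeroExtend (w y.1) y.2) :=
    PrimrecRat.ratEnum.comp (primrec₂_zeroExtend.comp (hw.comp Primrec.fst) Primrec.snd)
  have hpenalty : PrimrecRat fun y : α × ℕ => stagePenalty (zeroExtend (w y.1)) (m y.1)
      (ratEnum (tupleEntry (b y.1).unpair.1 0)) :=
    primrecRat_stagePenalty (hw.comp Primrec.fst) (hm.comp Primrec.fst)
      (PrimrecRat.ratEnum.comp (primrec_tupleEntry.comp hcenter (Primrec.const 0)))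
  refine primrecPred_exists_lt (PrimrecPred.and ?_ ?_) hm
  · exact hradius.le (PrimrecRat.const 1)
  · exact (hnorm.add ((hnorm.add (PrimrecRat.const 3)).mul hradius)).le (happrox.sq.add hpenalty)

theorem baireComputable_accumulationToProj (n : ℕ) :
    BaireComputable (PFun.lift (accumulationToProj n)) := by
  classical
  refine (isReadingBound_accumulationToProj n).baireComputable_lift Primrec₂.left ?_
  have hstage : Primrec fun x : List ℕ × ℕ => x.2 / 2 :=
    Primrec.nat_div.comp Primrec.snd (Primrec.const 2)
  have hball := primrec_unpair_fst hstage
  exact Primrec.ite (PrimrecPred.and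
    (Primrec.eq.comp (Primrec.nat_mod.comp Primrec.snd (Primrec.const 2)) (Primrec.const 1))
    (primrecPred_removable n Primrec.fst hstage hball)) hball (Primrec.const 0)

theorem baireComputable_tupleEntry (i : ℕ) :
    BaireComputable (PFun.lift fun (q : ℕ → ℕ) m => tupleEntry (q m) i) := by
  have hread : IsReadingBound (fun m _ => m + 1) fun (q : ℕ → ℕ) m => tupleEntry (q m) i :=
    fun q q' m h => by simp only [h m m.lt_succ_self]
  exact hread.baireComputable_lift (Primrec.succ.comp₂ Primrec₂.left)
    (primrec_tupleEntry.comp primrec₂_zeroExtend (Primrec.const i))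

end Computability

section Penalty

variable {k : Type*} [Field k] [LinearOrder k]

theorem testRadius_le_one (j : ℕ) : testRadius j ≤ 1 := by
  unfold testRadius
  rw [div_le_one (by positivity)]
  simp

theorem tent_nonneg (j : ℕ) (c : k) : 0 ≤ tent j c := le_max_left _ _

variable [IsStrictOrderedRing k]

theorem tent_le_one (j : ℕ) (c : k) : tent j c ≤ 1 := by
  have hradius : (testRadius j : k) ≤ 1 := by exact_mod_cast testRadius_le_one j
  exact max_le zero_le_one (by linarith [abs_nonneg (c - testCenter j)])

theorem tent_pos_iff {j : ℕ} {c : k} : 0 < tent j c ↔ |c - testCenter j| < testRadius j := by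
  simp [tent]

theorem abs_tent_sub_tent_le (j : ℕ) (c c' : k) : |tent j c - tent j c'| ≤ |c - c'| :=
  calc |tent j c - tent j c'|
      ≤ |(testRadius j - |c - testCenter j|) - (testRadius j - |c' - testCenter j|)| := by
        simpa [tent, max_comm] using abs_max_sub_max_le_abs
          ((testRadius j : k) - |c - testCenter j|) (testRadius j - |c' - testCenter j|) 0
    _ ≤ |(c' - testCenter j) - (c - testCenter j)| := by
        rw [sub_sub_sub_cancel_left]
        exact abs_abs_sub_abs_le _ _
    _ = |c - c'| := by rw [sub_sub_sub_cancel_right, abs_sub_comm]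

theorem penaltyTerm_mem_Icc (V : Set ℕ) (c : k) (j : ℕ) : penaltyTerm V c j ∈ Set.Icc 0 1 := by
  unfold penaltyTerm
  split_ifs
  · exact ⟨zero_le_one, le_rfl⟩
  · exact ⟨tent_nonneg j c, tent_le_one j c⟩

theorem penaltyTerm_le_penaltyTerm {V W : Set ℕ} {j : ℕ} (h : j ∈ V → j ∈ W) (c : k) :
    penaltyTerm V c j ≤ penaltyTerm W c j := by
  unfold penaltyTerm
  split_ifs with hV hW hW
  · exact le_rfl
  · exact absurd (h hV) hW
  · exact tent_le_one j c
  · exact le_rfl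

theorem abs_penaltyTerm_sub_le (V : Set ℕ) (c c' : k) (j : ℕ) :
    |penaltyTerm V c j - penaltyTerm V c' j| ≤ |c - c'| := by
  unfold penaltyTerm
  split_ifs
  · simp
  · exact abs_tent_sub_tent_le j c c'

theorem monotone_visited (p : ℕ → ℕ) : Monotone (visited p) :=
  fun _ _ hm _ ⟨e, he, h⟩ => ⟨e, he.trans_le hm, h⟩

theorem monotone_stagePenalty (p : ℕ → ℕ) (c : k) : Monotone fun m => stagePenalty p m c :=
  fun _ _ hm => (dyadicSum_le_dyadicSum fun _ _ =>
    penaltyTerm_le_penaltyTerm (fun hj => monotone_visited p hm hj) c).trans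
      (monotone_dyadicSum (fun j => (penaltyTerm_mem_Icc _ c j).1) hm)

theorem lipschitzWith_stagePenalty (p : ℕ → ℕ) (m : ℕ) :
    LipschitzWith 1 fun c : ℝ => stagePenalty p m c :=
  .mk_one fun c c' => abs_dyadicSum_sub_le (abs_nonneg _) fun j _ =>
    abs_penaltyTerm_sub_le (visited p m) c c' j

theorem ratCast_stagePenalty (p : ℕ → ℕ) (m : ℕ) (c : ℚ) :
    ((stagePenalty p m c : ℚ) : ℝ) = stagePenalty p m (c : ℝ) := by
  unfold stagePenalty
  rw [ratCast_dyadicSum]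
  congr 1
  ext j
  unfold penaltyTerm tent
  split_ifs <;> simp

theorem limitPenalty_nonneg (p : ℕ → ℕ) (c : ℝ) : 0 ≤ limitPenalty p c :=
  tsum_nonneg fun j => mul_nonneg (by positivity) (penaltyTerm_mem_Icc _ c j).1

theorem stagePenalty_le_limitPenalty (p : ℕ → ℕ) (m : ℕ) (c : ℝ) :
    stagePenalty p m c ≤ limitPenalty p c :=
  (dyadicSum_le_dyadicSum fun _ _ =>
    penaltyTerm_le_penaltyTerm (fun hj => Set.mem_iUnion_of_mem m hj) c).trans
      (dyadicSum_le_dyadicSeries (penaltyTerm_mem_Icc _ c) m)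

theorem exists_lt_stagePenalty {p : ℕ → ℕ} {c v : ℝ} (h : v < limitPenalty p c) :
    ∃ m, v < stagePenalty p m c := by
  obtain ⟨J, hJ⟩ :=
    ((tendsto_dyadicSum (penaltyTerm_mem_Icc _ c)).eventually (lt_mem_nhds h)).exists
  have hvisited : ∀ᶠ m in atTop, ∀ j ∈ Finset.range J, j ∈ ⋃ m, visited p m → j ∈ visited p m := by
    rw [eventually_all_finset]
    intro j _
    by_cases hj : j ∈ ⋃ m, visited p m
    · obtain ⟨m, hm⟩ := Set.mem_iUnion.mp hj
      filter_upwards [eventually_ge_atTop m] with m' hm' _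
      exact monotone_visited p hm' hm
    · exact Eventually.of_forall fun _ hj' => absurd hj' hj
  obtain ⟨m, hm, hJm⟩ := (hvisited.and (eventually_ge_atTop J)).exists
  refine ⟨m, hJ.trans_le ((dyadicSum_le_dyadicSum fun j hj => ?_).trans
    (monotone_dyadicSum (fun j => (penaltyTerm_mem_Icc _ c j).1) hJm))⟩
  exact penaltyTerm_le_penaltyTerm (hm j (Finset.mem_range.mpr hj)) c

end Penalty

section RemovedSet

variable {n : ℕ} {p : ℕ → ℕ} {m m' b e : ℕ}

theorem Removable.mono (h : Removable n p m b) (hm : m ≤ m') : Removable n p m' b := by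
  obtain ⟨e, he, hradius, hcert⟩ := h
  exact ⟨e, he.trans_le hm, hradius,
    hcert.trans (add_le_add_right (monotone_stagePenalty p _ hm) _)⟩

theorem accumulationToProj_even (n : ℕ) (p : ℕ → ℕ) (m : ℕ) :
    accumulationToProj n p (2 * m) = 0 := by
  simp [accumulationToProj]

open Classical in
theorem accumulationToProj_odd (n : ℕ) (p : ℕ → ℕ) (m : ℕ) :
    accumulationToProj n p (2 * m + 1) =
      if Removable n p m m.unpair.1 then m.unpair.1 else 0 := by
  have hmod : (2 * m + 1) % 2 = 1 := by omega
  have hdiv : (2 * m + 1) / 2 = m := by omega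
  simp [accumulationToProj, hmod, hdiv]

variable [NeZero n]

theorem removable_iff_normSqCertificate :
    Removable n p m b ↔ ∃ e < m, NormSqCertificate (fun z => stagePenalty p m (z 0))
      ((ratEnum (p e) : ℝ) ^ 2) ((euclideanSeq n).pt b.unpair.1) (nnratEnum b.unpair.2) := by
  refine exists_congr fun e => and_congr_right fun _ => and_congr (by norm_cast) ?_
  beta_reduce
  rw [euclideanSeq_pt_apply, ← ratCast_normSqEnum, Fin.val_zero, ← ratCast_stagePenalty]
  norm_cast

theorem lipschitzWith_stagePenalty_apply_zero (p : ℕ → ℕ) (m : ℕ) :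
    LipschitzWith 1 fun z : EuclideanSpace ℝ (Fin n) => stagePenalty p m (z 0) := by
  have hcoord : LipschitzWith 1 fun z : EuclideanSpace ℝ (Fin n) => z 0 :=
    .mk_one fun z z' => by
      simpa only [dist_eq_norm, PiLp.sub_apply] using PiLp.norm_apply_le (z - z') 0
  have hcomp := (lipschitzWith_stagePenalty p m).comp hcoord
  rwa [one_mul] at hcomp

theorem Removable.norm_sq_lt (h : Removable n p m b) {z : EuclideanSpace ℝ (Fin n)}
    (hz : z ∈ (euclideanSeq n).basicBall b) :
    ∃ e, ‖z‖ ^ 2 < (ratEnum (p e) : ℝ) ^ 2 + limitPenalty p (z 0) := by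
  obtain ⟨e, -, hcert⟩ := removable_iff_normSqCertificate.mp h
  exact ⟨e, (hcert.norm_sq_lt (lipschitzWith_stagePenalty_apply_zero p m) hz).trans_le
    (add_le_add_right (stagePenalty_le_limitPenalty p m _) _)⟩

theorem exists_removable_of_norm_sq_lt {z : EuclideanSpace ℝ (Fin n)}
    (h : ‖z‖ ^ 2 < (ratEnum (p e) : ℝ) ^ 2 + limitPenalty p (z 0)) :
    ∃ m b, z ∈ (euclideanSeq n).basicBall b ∧ Removable n p m b := by
  obtain ⟨m₀, hm₀⟩ := exists_lt_stagePenalty (sub_lt_iff_lt_add'.mpr h)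
  have hstage : ‖z‖ ^ 2 < (ratEnum (p e) : ℝ) ^ 2 + stagePenalty p (max m₀ (e + 1)) (z 0) :=
    (sub_lt_iff_lt_add'.mp hm₀).trans_le
      (add_le_add_right (monotone_stagePenalty p _ (le_max_left _ _)) _)
  obtain ⟨b, hb, hcert⟩ := (euclideanSeq n).exists_mem_basicBall_of_eventually
    (eventually_normSqCertificate (lipschitzWith_stagePenalty_apply_zero p _).continuous hstage)
  exact ⟨_, b, hb, removable_iff_normSqCertificate.mpr ⟨e, le_max_right m₀ (e + 1), hcert⟩⟩

theorem iUnion_basicBall_accumulationToProj (n : ℕ) [NeZero n] (p : ℕ → ℕ) :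
    (⋃ i, (euclideanSeq n).basicBall (accumulationToProj n p (2 * i + 1))) =
      {z | ∃ e, ‖z‖ ^ 2 < (ratEnum (p e) : ℝ) ^ 2 + limitPenalty p (z 0)} := by
  ext z
  simp only [Set.mem_iUnion, Set.mem_ofPred_eq, accumulationToProj_odd]
  constructor
  · rintro ⟨i, hi⟩
    split_ifs at hi with hr
    · exact hr.norm_sq_lt hi
    · rw [DenseSequence.basicBall_zero] at hi
      exact hi.elim
  · rintro ⟨e, h⟩
    obtain ⟨m, b, hb, hr⟩ := exists_removable_of_norm_sq_lt h
    refine ⟨Nat.pair b m, ?_⟩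
    rwa [Nat.unpair_pair, if_pos (hr.mono (Nat.right_le_pair b m))]

theorem exists_closeds_isName_accumulationToProj (n : ℕ) [NeZero n]
    (hbdd : BddAbove (Set.range fun e => (ratEnum (p e) : ℝ) ^ 2)) :
    ∃ A : Closeds (EuclideanSpace ℝ (Fin n)),
      ((euclideanSeq n).cauchyRep.prod (euclideanSeq n).negRep).IsName
        (accumulationToProj n p) (0, A) ∧
      ∀ z, z ∈ A ↔ (⨆ e, (ratEnum (p e) : ℝ) ^ 2) + limitPenalty p (z 0) ≤ ‖z‖ ^ 2 := by
  let A : Closeds (EuclideanSpace ℝ (Fin n)) :=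
    ⟨(⋃ i, (euclideanSeq n).basicBall (accumulationToProj n p (2 * i + 1)))ᶜ,
      (isOpen_iUnion fun _ => Metric.isOpen_ball).isClosed_compl⟩
  refine ⟨A, ⟨(euclideanSeq n).isName_of_dist_le fun i => ?_, rfl⟩, fun z => ?_⟩
  · rw [accumulationToProj_even, euclideanSeq_pt_zero, dist_self]
    positivity
  · change z ∈ (⋃ i, (euclideanSeq n).basicBall (accumulationToProj n p (2 * i + 1)))ᶜ ↔ _
    rw [iUnion_basicBall_accumulationToProj, ← le_sub_iff_add_le, ciSup_le_iff hbdd]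
    simp [le_sub_iff_add_le]

end RemovedSet

section ClusterPoints

variable {p : ℕ → ℕ} {s : ℕ → ℝ}

theorem abs_ratEnum_sub_le_of_isName (hp : realSeq.cauchyRep.seq.IsName p s) (e : ℕ) :
    |(ratEnum (p e) : ℝ) - s e.unpair.1| ≤ (2 ^ e.unpair.2)⁻¹ := by
  have hdist := realSeq.dist_le_of_isName (hp e.unpair.1) e.unpair.2
  rwa [Nat.pair_unpair, inv_pow] at hdist

theorem bddAbove_sq_ratEnum (hp : realSeq.cauchyRep.seq.IsName p s)
    (hs : Bornology.IsBounded (Set.range s)) :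
    BddAbove (Set.range fun e => (ratEnum (p e) : ℝ) ^ 2) := by
  obtain ⟨C, hC⟩ := hs.exists_norm_le
  refine ⟨(C + 1) ^ 2, Set.forall_mem_range.mpr fun e => ?_⟩
  have hterm : |s e.unpair.1| ≤ C := hC _ (Set.mem_range_self _)
  have herror : ((2 : ℝ) ^ e.unpair.2)⁻¹ ≤ 1 := inv_le_one_of_one_le₀ (one_le_pow₀ one_le_two)
  have hdist := (abs_sub_abs_le_abs_sub _ _).trans (abs_ratEnum_sub_le_of_isName hp e)
  rw [← sq_abs]
  exact pow_le_pow_left₀ (abs_nonneg _) (by linarith) 2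

theorem sq_le_of_mapClusterPt (hp : realSeq.cauchyRep.seq.IsName p s) {V : ℝ}
    (hV : ∀ e, (ratEnum (p e) : ℝ) ^ 2 ≤ V) {c : ℝ} (hc : MapClusterPt c atTop s) : c ^ 2 ≤ V := by
  have hterm (i : ℕ) : s i ∈ {x : ℝ | x ^ 2 ≤ V} :=
    le_of_tendsto ((hp i).2.pow 2) (Eventually.of_forall fun j => hV _)
  exact (isClosed_le (by fun_prop) continuous_const).mem_of_mapClusterPt hc
    (Eventually.of_forall hterm)

theorem mem_iUnion_visited_iff (hp : realSeq.cauchyRep.seq.IsName p s) (j : ℕ) :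
    j ∈ ⋃ m, visited p m ↔ ∃ i ≥ j.unpair.2, |s i - testCenter j| < testRadius j := by
  have hvisited (e : ℕ) :
      |ratEnum (p e) - testCenter j| + (((2 : ℕ) : ℚ) ^ e.unpair.2)⁻¹ < testRadius j ↔
        |(ratEnum (p e) : ℝ) - testCenter j| + (2 ^ e.unpair.2)⁻¹ < testRadius j := by
    rw [← Rat.cast_lt (K := ℝ)]
    push_cast
    rfl
  simp only [Set.mem_iUnion, visited, Set.mem_ofPred_eq, hvisited]
  constructor
  · rintro ⟨-, e, -, hi, he⟩
    have hdist := abs_sub_le (s e.unpair.1) (ratEnum (p e) : ℝ) (testCenter j : ℝ)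
    have happrox := abs_ratEnum_sub_le_of_isName hp e
    rw [abs_sub_comm] at happrox
    exact ⟨_, hi, by linarith⟩
  · rintro ⟨i, hi, hs⟩
    obtain ⟨l, hl⟩ := exists_pow_lt_of_lt_one (half_pos (sub_pos.mpr hs))
      (show (2 : ℝ)⁻¹ < 1 by norm_num)
    have hdist := abs_sub_le (ratEnum (p (Nat.pair i l)) : ℝ) (s i) (testCenter j : ℝ)
    have happrox := abs_ratEnum_sub_le_of_isName hp (Nat.pair i l)
    rw [inv_pow] at hl
    rw [Nat.unpair_pair] at happrox
    exact ⟨_, Nat.pair i l, Nat.lt_succ_self _, by simpa using hi, by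
      rw [Nat.unpair_pair]; linarith⟩

theorem tent_eq_zero_of_mapClusterPt (hp : realSeq.cauchyRep.seq.IsName p s) {c : ℝ}
    (hc : MapClusterPt c atTop s) {j : ℕ} (hj : j ∉ ⋃ m, visited p m) : tent j c = 0 := by
  refine (tent_nonneg j c).antisymm' (not_lt.mp fun hpos => hj ?_)
  have hopen : IsOpen {x : ℝ | |x - testCenter j| < testRadius j} :=
    isOpen_lt (by fun_prop) continuous_const
  have hfreq := hc.frequently (hopen.mem_nhds (tent_pos_iff.mp hpos))
  rw [mem_iUnion_visited_iff hp]
  exact frequently_atTop.mp hfreq _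

theorem exists_notMem_iUnion_visited_tent_pos (hp : realSeq.cauchyRep.seq.IsName p s) {c : ℝ}
    (hc : ¬MapClusterPt c atTop s) : ∃ j ∉ ⋃ m, visited p m, 0 < tent j c := by
  simp only [mapClusterPt_iff_frequently, not_forall, not_frequently] at hc
  obtain ⟨U, hU, hleaves⟩ := hc
  obtain ⟨ε, hε, hball⟩ := Metric.mem_nhds_iff.mp hU
  obtain ⟨τ, hτ⟩ := eventually_atTop.mp hleaves
  obtain ⟨k, hk⟩ := exists_nat_one_div_lt (half_pos hε)
  obtain ⟨q, hq⟩ := realSeq.dense.exists_dist_lt c (show (0 : ℝ) < 1 / (k + 1) by positivity)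
  have hcenter : testCenter (Nat.pair (Nat.pair q k) τ) = ratEnum q := by simp [testCenter]
  have hradius : (testRadius (Nat.pair (Nat.pair q k) τ) : ℝ) = 1 / (k + 1) := by
    simp [testRadius]
  refine ⟨Nat.pair (Nat.pair q k) τ, ?_, ?_⟩
  · rw [mem_iUnion_visited_iff hp, hcenter, hradius]
    rintro ⟨i, hi, hs⟩
    refine hτ i (by simpa using hi) (hball (Metric.mem_ball.mpr ?_))
    calc dist (s i) c ≤ |s i - ratEnum q| + dist c (ratEnum q : ℝ) := dist_triangle_right _ _ _
      _ < ε := by linarith [show dist c (ratEnum q : ℝ) < 1 / (k + 1) from hq]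
  · rw [tent_pos_iff, hcenter, hradius]
    exact hq

theorem limitPenalty_lt_limitPenalty (hp : realSeq.cauchyRep.seq.IsName p s) {c c' : ℝ}
    (hc : MapClusterPt c atTop s) (hc' : ¬MapClusterPt c' atTop s) :
    limitPenalty p c < limitPenalty p c' := by
  have hmin {j : ℕ} (hj : j ∉ ⋃ m, visited p m) :
      penaltyTerm (⋃ m, visited p m) c j = 0 := by
    rw [penaltyTerm, if_neg hj, tent_eq_zero_of_mapClusterPt hp hc hj]
  have hle (j : ℕ) :
      penaltyTerm (⋃ m, visited p m) c j ≤ penaltyTerm (⋃ m, visited p m) c' j := by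
    by_cases hj : j ∈ ⋃ m, visited p m
    · simp only [penaltyTerm, if_pos hj, le_rfl]
    · exact (hmin hj).trans_le (penaltyTerm_mem_Icc _ c' j).1
  obtain ⟨j, hj, hpos⟩ := exists_notMem_iUnion_visited_tent_pos hp hc'
  refine dyadicSeries_lt_dyadicSeries (penaltyTerm_mem_Icc _ c) (penaltyTerm_mem_Icc _ c') hle
    (j := j) ?_
  rwa [hmin hj, penaltyTerm, if_neg hj]

end ClusterPoints

theorem isName_tupleEntry {n : ℕ} {q : ℕ → ℕ} {z : EuclideanSpace ℝ (Fin n)}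
    (hq : (euclideanSeq n).cauchyRep.IsName q z) (i : Fin n) :
    realSeq.cauchyRep.IsName (fun m => tupleEntry (q m) i) (z i) := by
  refine ⟨fun l m hlm => le_trans ?_ (hq.1 l m hlm), ?_⟩
  · rw [dist_eq_norm, dist_eq_norm]
    exact PiLp.norm_apply_le ((euclideanSeq n).pt (q l) - (euclideanSeq n).pt (q m)) i
  · have hcont : Continuous fun z : EuclideanSpace ℝ (Fin n) => z i := by fun_prop
    exact (hcont.tendsto z).comp hq.2

theorem exists_apply_eq_and_norm_sq_eq {ι : Type*} [Fintype ι] [Nontrivial ι] (i : ι) {c w : ℝ}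
    (h : c ^ 2 ≤ w) : ∃ z : EuclideanSpace ℝ ι, z i = c ∧ ‖z‖ ^ 2 = w := by
  classical
  obtain ⟨j, hj⟩ := exists_ne i
  refine ⟨EuclideanSpace.single i c + EuclideanSpace.single j √(w - c ^ 2), ?_, ?_⟩
  · simp [hj.symm]
  · rw [norm_add_sq_real, EuclideanSpace.inner_single_left]
    simp [hj, Real.sq_sqrt (sub_nonneg.mpr h)]

theorem bwt_reducible_projNeg {n : ℕ} (hn : 2 ≤ n) :
    StrongWeihrauchReducible (BWT realSeq) (projNeg (euclideanSeq n)) := by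
  have : NeZero n := ⟨by omega⟩
  have : Nontrivial (Fin n) := Fin.nontrivial_iff_two_le.mpr hn
  refine .of_lift (baireComputable_accumulationToProj n) (baireComputable_tupleEntry 0) ?_
  rintro p (s : ℕ → ℝ) (hp : realSeq.cauchyRep.seq.IsName p s) ⟨c, hcompact, hc⟩
  have hbdd := bddAbove_sq_ratEnum hp (hcompact.isBounded.subset subset_closure)
  obtain ⟨A, hname, hA⟩ := exists_closeds_isName_accumulationToProj n hbdd
  have hsq := sq_le_of_mapClusterPt hp (le_ciSup hbdd) hc
  obtain ⟨z, hzc, hznorm⟩ := exists_apply_eq_and_norm_sq_eq (0 : Fin n)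
    (hsq.trans (le_add_of_nonneg_right (limitPenalty_nonneg p c)))
  have hzA : z ∈ A := (hA z).mpr (by rw [hzc, hznorm])
  refine ⟨(0, A), hname, ?_, ?_⟩
  · obtain ⟨y, hy, hdist⟩ := A.isClosed.exists_infDist_eq_dist ⟨z, hzA⟩ 0
    exact ⟨y, hy, hdist.symm⟩
  · rintro q (y : EuclideanSpace ℝ (Fin n)) ⟨hyA, hdist⟩ hq
    refine ⟨y 0, ⟨hcompact, ?_⟩, isName_tupleEntry hq 0⟩
    have hnorm : ‖y‖ ≤ ‖z‖ := by
      simpa only [dist_zero_left] using hdist.trans_le (Metric.infDist_le_dist_of_mem hzA)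
    have hpenalty : limitPenalty p (y 0) ≤ limitPenalty p c := by
      have := pow_le_pow_left₀ (norm_nonneg y) hnorm 2
      linarith [(hA y).mp hyA]
    exact not_not.mp fun hy => hpenalty.not_gt (limitPenalty_lt_limitPenalty hp hc hy)

/-! ### A curve that fills `ℝⁿ` -/

section CurveDefinitions

variable {k : Type*} [Field k] [LinearOrder k] [IsStrictOrderedRing k] [FloorRing k]

/-- Distance to the nearest integer. -/
def triangleWave (x : k) : k := |x - round x|

/-- A continuous function of period `1` that is `0` on `[0, 1/4]` and `1` on `[1/2, 3/4]`; it reads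
a binary digit `d` off a number whose first quaternary digit after the point is `2 d`. -/
def plateauWave (x : k) : k := max 0 (min 1 (3 / 2 - 4 * triangleWave (x - 5 / 8)))

/-- The `j`-th binary digit (in general, a number in `[0, 1]`) of the `i`-th coordinate of
Schoenberg's space-filling curve.  The coordinates of the curve in `[0, 1]ⁿ` use the quaternary
digits of `t` in turn. -/
def curveDigit (n i : ℕ) (t : k) (j : ℕ) : k := plateauWave (4 ^ (n * j + i + 1) * t)

/-- Approximation, with `J` binary digits, to the `i`-th coordinate of a curve that, for `t` in
`[N, N + 1]`, covers the cube `[-N, N]ⁿ`: Schoenberg's curve in `[-1, 1]ⁿ` is multiplied by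
`t - triangleWave t`, which is `N` for `t` in `[N, N + 1/2]`. -/
def curveApprox (n J i : ℕ) (t : k) : k :=
  (t - triangleWave t) * (2 * dyadicSum (curveDigit n i t) J - 1)

end CurveDefinitions

/-- The `i`-th coordinate of the limit of the curves `curveApprox n J`. -/
noncomputable def curveLimit (n i : ℕ) (t : ℝ) : ℝ :=
  (t - triangleWave t) * (2 * dyadicSeries (curveDigit n i t) - 1)

/-- The point with parameter `t` on the `J`-th approximating curve. -/
noncomputable def curveApproxPoint (n J : ℕ) (t : ℝ) : EuclideanSpace ℝ (Fin n) :=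
  WithLp.toLp 2 fun i => curveApprox n J i t

/-- The point with parameter `t` on a curve that fills `ℝⁿ`. -/
noncomputable def curvePoint (n : ℕ) (t : ℝ) : EuclideanSpace ℝ (Fin n) :=
  WithLp.toLp 2 fun i => curveLimit n i t

@[simp, norm_cast]
theorem ratCast_triangleWave (q : ℚ) : ((triangleWave q : ℚ) : ℝ) = triangleWave (q : ℝ) := by
  simp [triangleWave, Rat.round_cast]

@[simp, norm_cast]
theorem ratCast_plateauWave (q : ℚ) : ((plateauWave q : ℚ) : ℝ) = plateauWave (q : ℝ) := by
  simp [plateauWave]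

@[simp, norm_cast]
theorem ratCast_curveDigit (n i : ℕ) (q : ℚ) (j : ℕ) :
    ((curveDigit n i q j : ℚ) : ℝ) = curveDigit n i (q : ℝ) j := by
  simp [curveDigit]

@[simp, norm_cast]
theorem ratCast_curveApprox (n J i : ℕ) (q : ℚ) :
    ((curveApprox n J i q : ℚ) : ℝ) = curveApprox n J i (q : ℝ) := by
  simp [curveApprox]

namespace PrimrecRat

variable {α : Type*} [Primcodable α]

theorem triangleWave {f : α → ℚ} (hf : PrimrecRat f) : PrimrecRat fun x => triangleWave (f x) :=
  (hf.fract.min ((const 1).sub hf.fract)).of_eq fun _ => (abs_sub_round_eq_min _).symm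

theorem plateauWave {f : α → ℚ} (hf : PrimrecRat f) : PrimrecRat fun x => plateauWave (f x) :=
  (const 0).max ((const 1).min
    ((const (3 / 2)).sub ((const 4).mul (hf.sub (const (5 / 8))).triangleWave)))

theorem curveDigit (n : ℕ) {i j : α → ℕ} {t : α → ℚ} (hi : Primrec i) (ht : PrimrecRat t)
    (hj : Primrec j) : PrimrecRat fun x => curveDigit n (i x) (t x) (j x) := by
  have hexp : Primrec fun x => n * j x + i x + 1 :=
    Primrec.succ.comp (Primrec.nat_add.comp (Primrec.nat_mul.comp (Primrec.const n) hj) hi)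
  have hpow : PrimrecRat fun x => (4 : ℚ) ^ (n * j x + i x + 1) :=
    (natCast (primrec_nat_pow (Primrec.const 4) hexp)).of_eq fun x => by simp
  exact (hpow.mul ht).plateauWave

theorem curveApprox (n : ℕ) {J i : α → ℕ} {t : α → ℚ} (hJ : Primrec J) (hi : Primrec i)
    (ht : PrimrecRat t) : PrimrecRat fun x => curveApprox n (J x) (i x) (t x) := by
  have hdigit : PrimrecRat fun y : α × ℕ => _root_.curveDigit n (i y.1) (t y.1) y.2 :=
    curveDigit n (hi.comp Primrec.fst) (ht.comp Primrec.fst) Primrec.snd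
  exact (ht.sub ht.triangleWave).mul
    (((const 2).mul (primrecRat_dyadicSum hdigit hJ)).sub (const 1))

end PrimrecRat

theorem abs_triangleWave_sub_le (x y : ℝ) : |triangleWave x - triangleWave y| ≤ |x - y| := by
  have hle (x y : ℝ) : triangleWave x - triangleWave y ≤ |x - y| :=
    sub_le_iff_le_add.mpr ((round_le x (round y)).trans (abs_sub_le x y (round y)))
  exact abs_sub_le_iff.mpr ⟨hle x y, abs_sub_comm x y ▸ hle y x⟩

theorem abs_sub_triangleWave_le (t : ℝ) : |t - triangleWave t| ≤ |t| + 1 := by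
  have hhalf : |triangleWave t| ≤ 1 / 2 := (abs_abs _).trans_le (abs_sub_round t)
  linarith [abs_sub t (triangleWave t)]

theorem plateauWave_mem_Icc (x : ℝ) : plateauWave x ∈ Set.Icc 0 1 :=
  ⟨le_max_left _ _, max_le zero_le_one (min_le_left _ _)⟩

theorem abs_plateauWave_sub_le (x y : ℝ) : |plateauWave x - plateauWave y| ≤ 4 * |x - y| := by
  have htri := abs_triangleWave_sub_le (x - 5 / 8) (y - 5 / 8)
  rw [sub_sub_sub_cancel_right] at htri
  calc |plateauWave x - plateauWave y|
      ≤ |min 1 (3 / 2 - 4 * triangleWave (x - 5 / 8)) -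
          min 1 (3 / 2 - 4 * triangleWave (y - 5 / 8))| := by
        simpa [plateauWave] using abs_max_sub_max_le_max (0 : ℝ) _ 0 _
    _ ≤ |(3 / 2 - 4 * triangleWave (x - 5 / 8)) - (3 / 2 - 4 * triangleWave (y - 5 / 8))| := by
        simpa only [sub_self, abs_zero, abs_nonneg, max_eq_right] using
          abs_min_sub_min_le_max (1 : ℝ) _ 1 _
    _ = 4 * |triangleWave (x - 5 / 8) - triangleWave (y - 5 / 8)| := by
        rw [sub_sub_sub_cancel_left, ← mul_sub, abs_mul, abs_sub_comm, abs_of_pos four_pos]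
    _ ≤ 4 * |x - y| := by linarith

theorem curveDigit_mem_Icc (n i : ℕ) (t : ℝ) (j : ℕ) : curveDigit n i t j ∈ Set.Icc 0 1 :=
  plateauWave_mem_Icc _

theorem abs_dyadicSum_curveDigit_sub_le {n i : ℕ} (hi : i < n) (J : ℕ) (q t : ℝ) :
    |dyadicSum (curveDigit n i q) J - dyadicSum (curveDigit n i t) J| ≤
      4 * 4 ^ (n * J) * |q - t| := by
  refine abs_dyadicSum_sub_le (by positivity) fun j hj => (abs_plateauWave_sub_le _ _).trans ?_
  have hexp : n * j + i + 1 ≤ n * J :=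
    calc n * j + i + 1 ≤ n * (j + 1) := by rw [Nat.mul_succ]; omega
      _ ≤ n * J := Nat.mul_le_mul_left n hj
  rw [← mul_sub, abs_mul, abs_of_pos (by positivity), mul_assoc]
  gcongr
  norm_num

theorem abs_curveApprox_sub_curveLimit_le (n J i : ℕ) (t : ℝ) :
    |curveApprox n J i t - curveLimit n i t| ≤ 2 * (|t| + 1) * (2 ^ J)⁻¹ := by
  have hlower := dyadicSum_le_dyadicSeries (curveDigit_mem_Icc n i t) J
  have hupper := dyadicSeries_le_dyadicSum_add (curveDigit_mem_Icc n i t) J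
  have hpow : (0 : ℝ) < (2 ^ J)⁻¹ := by positivity
  have hsum : |dyadicSum (curveDigit n i t) J - dyadicSeries (curveDigit n i t)| ≤ (2 ^ J)⁻¹ :=
    abs_sub_le_iff.mpr ⟨by linarith, by linarith⟩
  calc |curveApprox n J i t - curveLimit n i t|
      = |t - triangleWave t| *
          (2 * |dyadicSum (curveDigit n i t) J - dyadicSeries (curveDigit n i t)|) := by
        rw [curveApprox, curveLimit, ← mul_sub, abs_mul, sub_sub_sub_cancel_right, ← mul_sub,
          abs_mul, abs_two]
    _ ≤ (|t| + 1) * (2 * (2 ^ J)⁻¹) := by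
        gcongr
        exact abs_sub_triangleWave_le t
    _ = 2 * (|t| + 1) * (2 ^ J)⁻¹ := by ring

theorem abs_curveApprox_sub_le {n i : ℕ} (hi : i < n) (J : ℕ) (q t : ℝ) :
    |curveApprox n J i q - curveApprox n J i t| ≤ (2 + 8 * (|t| + 1) * 4 ^ (n * J)) * |q - t| := by
  set scale : ℝ → ℝ := fun t => t - triangleWave t
  set sum : ℝ → ℝ := fun t => dyadicSum (curveDigit n i t) J
  have hscale : |scale q - scale t| ≤ 2 * |q - t| := by
    have htri := abs_triangleWave_sub_le q t
    calc |scale q - scale t| = |(q - t) - (triangleWave q - triangleWave t)| := by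
          congr 1; ring
      _ ≤ 2 * |q - t| := by linarith [abs_sub (q - t) (triangleWave q - triangleWave t)]
  have hsum : |2 * sum q - 1| ≤ 1 := by
    have hnonneg := dyadicSum_nonneg (fun j => (curveDigit_mem_Icc n i q j).1) J
    have hle := dyadicSum_le_one (fun j => (curveDigit_mem_Icc n i q j).2) J
    exact abs_le.mpr ⟨by linarith, by linarith⟩
  calc |curveApprox n J i q - curveApprox n J i t|
      = |(scale q - scale t) * (2 * sum q - 1) + scale t * (2 * (sum q - sum t))| := by
        congr 1; simp only [curveApprox, scale, sum]; ring
    _ ≤ |scale q - scale t| * |2 * sum q - 1| + |scale t| * (2 * |sum q - sum t|) := by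
        refine (abs_add_le _ _).trans_eq ?_
        rw [abs_mul, abs_mul, abs_mul, abs_two]
    _ ≤ 2 * |q - t| * 1 + (|t| + 1) * (2 * (4 * 4 ^ (n * J) * |q - t|)) := by
        gcongr
        · exact abs_sub_triangleWave_le t
        · exact abs_dyadicSum_curveDigit_sub_le hi J q t
    _ = (2 + 8 * (|t| + 1) * 4 ^ (n * J)) * |q - t| := by ring

theorem dist_le_of_forall_abs_sub_le {ι : Type*} [Fintype ι] {y z : EuclideanSpace ℝ ι} {δ : ℝ}
    (h : ∀ i, |y i - z i| ≤ δ) : dist y z ≤ Fintype.card ι * δ := by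
  have hsum : dist y z ≤ ∑ i, |y i - z i| := by
    rw [EuclideanSpace.dist_eq]
    refine Real.sqrt_le_iff.mpr ⟨Finset.sum_nonneg fun i _ => abs_nonneg _, ?_⟩
    exact Finset.sum_sq_le_sq_sum_of_nonneg fun i _ => abs_nonneg _
  refine hsum.trans ?_
  simpa using Finset.sum_le_card_nsmul Finset.univ _ δ fun i _ => h i

/-- The factor `4 ^ (-n k)` of the tolerance compensates the Lipschitz constant of the `k`-th
approximating curve. -/
theorem dist_curveApproxPoint_curvePoint_le {n k : ℕ} {q t : ℝ}
    (h : |q - t| ≤ (4 ^ ((n + 1) * k))⁻¹) :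
    dist (curveApproxPoint n k q) (curvePoint n t) ≤ 12 * n * (|t| + 1) * (2 ^ k)⁻¹ := by
  have hlip : (2 + 8 * (|t| + 1) * 4 ^ (n * k)) * |q - t| ≤ 10 * (|t| + 1) * (2 ^ k)⁻¹ := by
    have hone : (1 : ℝ) ≤ (|t| + 1) * 4 ^ (n * k) :=
      one_le_mul_of_one_le_of_one_le (by linarith [abs_nonneg t]) (one_le_pow₀ (by norm_num))
    calc (2 + 8 * (|t| + 1) * 4 ^ (n * k)) * |q - t|
        ≤ 10 * (|t| + 1) * 4 ^ (n * k) * (4 ^ ((n + 1) * k))⁻¹ := by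
          gcongr
          linarith
      _ = 10 * (|t| + 1) * (4 ^ k)⁻¹ := by
          rw [add_mul, one_mul, pow_add]
          field_simp
      _ ≤ 10 * (|t| + 1) * (2 ^ k)⁻¹ := by
          gcongr
          norm_num
  have hcoord (i : Fin n) : |curveApproxPoint n k q i - curvePoint n t i| ≤
      12 * (|t| + 1) * (2 ^ k)⁻¹ :=
    calc |curveApproxPoint n k q i - curvePoint n t i|
        ≤ |curveApprox n k i q - curveApprox n k i t| +
            |curveApprox n k i t - curveLimit n i t| := abs_sub_le _ _ _
      _ ≤ 12 * (|t| + 1) * (2 ^ k)⁻¹ := by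
          linarith [abs_curveApprox_sub_le i.2 k q t, abs_curveApprox_sub_curveLimit_le n k i t]
  refine (dist_le_of_forall_abs_sub_le hcoord).trans_eq ?_
  rw [Fintype.card_fin]
  ring

theorem continuous_curvePoint (n : ℕ) : Continuous (curvePoint n) := by
  have htri : Continuous (triangleWave : ℝ → ℝ) :=
    (LipschitzWith.of_dist_le_mul (K := 1) fun x y => by
      simpa [Real.dist_eq] using abs_triangleWave_sub_le x y).continuous
  have hplateau : Continuous (plateauWave : ℝ → ℝ) :=
    (LipschitzWith.of_dist_le_mul (K := 4) fun x y => by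
      simpa [Real.dist_eq] using abs_plateauWave_sub_le x y).continuous
  refine (PiLp.continuous_toLp 2 _).comp (continuous_pi fun i => ?_)
  have hseries : Continuous fun t => dyadicSeries (curveDigit n i t) :=
    continuous_dyadicSeries (fun j => hplateau.comp (continuous_const_mul _))
      (curveDigit_mem_Icc n i)
  exact (continuous_id.sub htri).mul ((hseries.const_mul 2).sub continuous_const)

theorem natCast_mul_inv_two_pow_le (b e : ℕ) :
    (b : ℝ) * (2 ^ (b + e))⁻¹ ≤ (2 ^ e)⁻¹ := by
  have hb : (b : ℝ) ≤ 2 ^ b := by exact_mod_cast Nat.lt_two_pow_self.le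
  calc (b : ℝ) * (2 ^ (b + e))⁻¹ ≤ 2 ^ b * (2 ^ (b + e))⁻¹ := by gcongr
    _ = (2 ^ e)⁻¹ := by rw [pow_add]; field_simp

/-- The level of approximation that, by `natCast_mul_inv_two_pow_le`, yields the `m`-th entry of a
name of `curvePoint n t` if `a` is the first entry of a name of `t`, so that `|t| + 1 ≤ a + 2`. -/
def curveLevel (n m a : ℕ) : ℕ := 12 * n * (a + 2) + (m + 1)

/-- The entry of a name of `t` that is read in order to approximate `curvePoint n t` on the level
`curveLevel n m a`. -/
def curveReadIndex (n m a : ℕ) : ℕ := 2 * ((n + 1) * curveLevel n m a)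

theorem primrec₂_curveLevel (n : ℕ) : Primrec₂ (curveLevel n) :=
  Primrec.nat_add.comp₂
    (Primrec.nat_mul.comp₂ (Primrec₂.const (12 * n))
      (Primrec.nat_add.comp₂ Primrec₂.right (Primrec₂.const 2)))
    (Primrec.succ.comp₂ Primrec₂.left)

theorem primrec₂_curveReadIndex (n : ℕ) : Primrec₂ (curveReadIndex n) :=
  Primrec.nat_mul.comp₂ (Primrec₂.const 2)
    (Primrec.nat_mul.comp₂ (Primrec₂.const (n + 1)) (primrec₂_curveLevel n))

theorem exists_primrec_curveApproxPoint (n : ℕ) : ∃ c : ℕ × ℕ → ℕ, Primrec c ∧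
    ∀ J e, (euclideanSeq n).pt (c (J, e)) = curveApproxPoint n J (ratEnum e) := by
  obtain ⟨f, hf, hfeq⟩ : PrimrecRat fun x : (ℕ × ℕ) × ℕ =>
      curveApprox n x.1.1 x.2 (ratEnum x.1.2) :=
    .curveApprox n (Primrec.fst.comp Primrec.fst) Primrec.snd
      (PrimrecRat.ratEnum.comp (Primrec.snd.comp Primrec.fst))
  obtain ⟨c, hc, hceq⟩ := exists_primrec_tupleCode n (f := fun (x : ℕ × ℕ) i => f (x, i)) hf
  refine ⟨c, hc, fun J e => ?_⟩
  ext i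
  rw [euclideanSeq_pt_apply, hceq _ _ i.2, hfeq, ratCast_curveApprox]
  rfl

theorem abs_add_one_le_of_isName {p : ℕ → ℕ} {t : ℝ} (hp : realSeq.cauchyRep.IsName p t) :
    |t| + 1 ≤ (p 0 + 2 : ℕ) := by
  have hdist : |(ratEnum (p 0) : ℝ) - t| ≤ 1 :=
    (realSeq.dist_le_of_isName hp 0).trans_eq (pow_zero _)
  have hcode : |(ratEnum (p 0) : ℝ)| ≤ p 0 := by exact_mod_cast abs_ratEnum_le (p 0)
  have htri := abs_sub_abs_le_abs_sub t (ratEnum (p 0) : ℝ)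
  rw [abs_sub_comm] at htri
  push_cast
  linarith

theorem dist_curveApproxPoint_curvePoint_le_of_isName (n : ℕ) {p : ℕ → ℕ} {t : ℝ}
    (hp : realSeq.cauchyRep.IsName p t) (m : ℕ) :
    dist (curveApproxPoint n (curveLevel n m (p 0)) (ratEnum (p (curveReadIndex n m (p 0)))))
      (curvePoint n t) ≤ 2⁻¹ ^ (m + 1) := by
  set k := curveLevel n m (p 0)
  have hread : |(ratEnum (p (curveReadIndex n m (p 0))) : ℝ) - t| ≤ (4 ^ ((n + 1) * k))⁻¹ := by
    refine (realSeq.dist_le_of_isName hp (curveReadIndex n m (p 0))).trans_eq ?_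
    change 2⁻¹ ^ (2 * ((n + 1) * k)) = _
    rw [inv_pow, pow_mul]
    norm_num
  calc dist (curveApproxPoint n k (ratEnum (p (curveReadIndex n m (p 0))))) (curvePoint n t)
      ≤ 12 * n * (|t| + 1) * (2 ^ k)⁻¹ := dist_curveApproxPoint_curvePoint_le hread
    _ ≤ 12 * n * (p 0 + 2 : ℕ) * (2 ^ k)⁻¹ := by
        gcongr
        exact abs_add_one_le_of_isName hp
    _ = (12 * n * (p 0 + 2) : ℕ) * (2 ^ k)⁻¹ := by push_cast; rfl
    _ ≤ (2 ^ (m + 1))⁻¹ := natCast_mul_inv_two_pow_le _ (m + 1)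
    _ = 2⁻¹ ^ (m + 1) := (inv_pow _ _).symm

theorem exists_computable_curvePoint (n : ℕ) : ∃ K : (ℕ → ℕ) → ℕ → ℕ,
    BaireComputable (PFun.lift K) ∧ ∀ p t, realSeq.cauchyRep.IsName p t →
      (euclideanSeq n).cauchyRep.IsName (K p) (curvePoint n t) := by
  obtain ⟨c, hc, hcpt⟩ := exists_primrec_curveApproxPoint n
  refine ⟨fun p m => c (curveLevel n m (p 0), p (curveReadIndex n m (p 0))), ?_, fun p t hp => ?_⟩
  · refine IsReadingBound.baireComputable_lift (len := fun m a => curveReadIndex n m a + 1)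
      (fun p p' m h => ?_) (Primrec.succ.comp₂ (primrec₂_curveReadIndex n)) ?_
    · rw [h _ (Nat.lt_succ_self _), h 0 (Nat.succ_pos _)]
    · have hfirst : Primrec fun x : List ℕ × ℕ => zeroExtend x.1 0 :=
        primrec₂_zeroExtend.comp Primrec.fst (Primrec.const 0)
      exact hc.comp (((primrec₂_curveLevel n).comp Primrec.snd hfirst).pair
        (primrec₂_zeroExtend.comp Primrec.fst
          ((primrec₂_curveReadIndex n).comp Primrec.snd hfirst)))
  · refine (euclideanSeq n).isName_of_dist_le fun m => ?_
    rw [hcpt]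
    exact dist_curveApproxPoint_curvePoint_le_of_isName n hp m

theorem triangleWave_natCast_add (N : ℕ) {x : ℝ} (h0 : 0 ≤ x) (h1 : x ≤ 1 / 2) :
    triangleWave (N + x) = x := by
  rw [triangleWave, abs_sub_round_eq_min, Int.fract_natCast_add,
    Int.fract_eq_self.mpr ⟨h0, by linarith⟩, min_eq_left (by linarith)]

theorem plateauWave_intCast_add_of_le (z : ℤ) {w : ℝ} (h0 : 0 ≤ w) (h1 : w ≤ 1 / 4) :
    plateauWave (z + w) = 0 := by
  have hfar : 3 / 8 ≤ triangleWave (z + w - 5 / 8) := by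
    rw [triangleWave]
    rcases le_or_gt z (round (z + w - 5 / 8)) with hz | hz
    · have : (z : ℝ) ≤ round (z + w - 5 / 8) := by exact_mod_cast hz
      rw [abs_of_nonpos] <;> linarith
    · have : (round (z + w - 5 / 8) : ℝ) + 1 ≤ z := by exact_mod_cast hz
      rw [abs_of_nonneg] <;> linarith
  exact max_eq_left (min_le_of_right_le (by linarith))

theorem plateauWave_intCast_add_of_ge (z : ℤ) {w : ℝ} (h0 : 1 / 2 ≤ w) (h1 : w ≤ 3 / 4) :
    plateauWave (z + w) = 1 := by
  have hnear : triangleWave (z + w - 5 / 8) ≤ 1 / 8 :=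
    (round_le _ z).trans (abs_le.mpr ⟨by linarith, by linarith⟩)
  rw [plateauWave, min_eq_left (by linarith), max_eq_right zero_le_one]

theorem plateauWave_intCast_add (z : ℤ) (d : Fin 2) {w : ℝ} (h0 : (d : ℝ) / 2 ≤ w)
    (h1 : w ≤ d / 2 + 1 / 4) : plateauWave (z + w) = d := by
  fin_cases d
  · simpa using plateauWave_intCast_add_of_le z (by simpa using h0) (by simpa using h1)
  · simpa using plateauWave_intCast_add_of_ge z (by simpa using h0) (by norm_num at h1; linarith)

theorem exists_pow_mul_ofDigits_eq {b : ℕ} (D : ℕ → Fin b) (l : ℕ) :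
    ∃ z : ℕ, (b : ℝ) ^ l * Real.ofDigits D = z + Real.ofDigits fun j => D (j + l) := by
  have hb : (b : ℝ) ≠ 0 := Nat.cast_ne_zero.mpr (Fin.pos (D 0)).ne'
  refine ⟨∑ j ∈ Finset.range l, D j * b ^ (l - (j + 1)), ?_⟩
  rw [Real.ofDigits_eq_sum_add_ofDigits D l, mul_add, Finset.mul_sum,
    mul_inv_cancel_left₀ (pow_ne_zero l hb)]
  push_cast
  refine congrArg (· + _) (Finset.sum_congr rfl fun j hj => ?_)
  have hjl : j + 1 ≤ l := Finset.mem_range.mp hj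
  rw [Real.ofDigitsTerm, pow_sub₀ _ hb hjl, mul_left_comm]

theorem ofDigits_mem_Icc {b : ℕ} (D : ℕ → Fin b) :
    Real.ofDigits D ∈ Set.Icc ((D 0 : ℝ) / b) (D 0 / b + 1 / b) := by
  have hsplit : Real.ofDigits D = D 0 / b + Real.ofDigits (fun j => D (j + 1)) / b := by
    rw [Real.ofDigits_eq_sum_add_ofDigits D 1]
    simp [Real.ofDigitsTerm, div_eq_mul_inv, mul_comm]
  rw [hsplit]
  constructor
  · exact le_add_of_nonneg_right (div_nonneg (Real.ofDigits_nonneg _) b.cast_nonneg)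
  · gcongr
    exact Real.ofDigits_le_one _

/-- The number in `[0, 1]` with the quaternary digits `2 d₀, 2 d₁, …`, from which `plateauWave`
recovers the binary digits `d₀, d₁, …`. -/
noncomputable def doubledDigits (D : ℕ → Fin 2) : ℝ :=
  Real.ofDigits fun l => (⟨2 * D l, by omega⟩ : Fin 4)

theorem plateauWave_doubledDigits (N : ℕ) (D : ℕ → Fin 2) (l : ℕ) :
    plateauWave (4 ^ (l + 1) * ((N : ℝ) + doubledDigits D / 4)) = D l := by
  obtain ⟨z, hz⟩ := exists_pow_mul_ofDigits_eq (fun l => (⟨2 * D l, by omega⟩ : Fin 4)) l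
  have hmem := ofDigits_mem_Icc fun j => (⟨2 * D (j + l), by omega⟩ : Fin 4)
  rw [← doubledDigits] at hz
  set w := Real.ofDigits fun j => (⟨2 * D (j + l), by omega⟩ : Fin 4)
  have harg : (4 : ℝ) ^ (l + 1) * (N + doubledDigits D / 4) =
      ((4 ^ (l + 1) * N + z : ℤ) : ℝ) + w := by
    push_cast at hz ⊢
    rw [pow_succ]
    linear_combination hz
  rw [harg]
  refine plateauWave_intCast_add _ (D l) ?_ ?_
  · refine le_of_eq_of_le ?_ hmem.1
    simp; ring
  · refine hmem.2.trans_eq ?_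
    simp; ring

theorem dyadicSeries_eq_ofDigits (D : ℕ → Fin 2) :
    dyadicSeries (fun j => (D j : ℝ)) = Real.ofDigits D :=
  tsum_congr fun j => by simp [Real.ofDigitsTerm, mul_comm]

theorem exists_curvePoint_eq {n N : ℕ} (hN : 0 < N) {a : EuclideanSpace ℝ (Fin n)}
    (ha : ‖a‖ ≤ N) : ∃ t ∈ Set.Icc (N : ℝ) (N + 1), curvePoint n t = a := by
  rcases eq_zero_or_neZero n with rfl | hn
  · exact ⟨N, ⟨le_rfl, by linarith⟩, Subsingleton.elim _ _⟩
  have hN' : (0 : ℝ) < N := by exact_mod_cast hN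
  have hdigits (i : Fin n) : ∃ D : ℕ → Fin 2, Real.ofDigits D = (a i / N + 1) / 2 := by
    have hcoord : |a i| ≤ N := (PiLp.norm_apply_le a i).trans ha
    have hratio : |a i / N| ≤ 1 := by
      rw [abs_div, abs_of_pos hN']
      exact div_le_one_of_le₀ hcoord hN'.le
    obtain ⟨hge, hle⟩ := abs_le.mp hratio
    obtain ⟨D, -, hD⟩ := Real.ofDigits_SurjOn one_lt_two
      (show (a i / N + 1) / 2 ∈ Set.Icc (0 : ℝ) 1 from ⟨by linarith, by linarith⟩)
    exact ⟨D, hD⟩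
  choose D hD using hdigits
  set v := doubledDigits fun l => D (Fin.ofNat n l) (l / n)
  have hv0 : 0 ≤ v := Real.ofDigits_nonneg _
  have hv1 : v ≤ 1 := Real.ofDigits_le_one _
  refine ⟨N + v / 4, ⟨by linarith, by linarith⟩, ?_⟩
  ext i
  have hdigit : curveDigit n i ((N : ℝ) + v / 4) = fun j => (D i j : ℝ) := by
    funext j
    have hmod : Fin.ofNat n (n * j + i) = i := by
      ext
      simp [Nat.mod_eq_of_lt i.2]
    have hdiv : (n * j + i) / n = j := by
      rw [Nat.mul_add_div (NeZero.pos n), Nat.div_eq_of_lt i.2, add_zero]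
    rw [curveDigit, plateauWave_doubledDigits, hmod, hdiv]
  change curveLimit n i (N + v / 4) = a i
  rw [curveLimit, hdigit, dyadicSeries_eq_ofDigits, hD,
    triangleWave_natCast_add N (by linarith) (by linarith)]
  field_simp
  ring

/-! ### Projections from accumulation points -/

/-- The `T`-th rational parameter that is considered on level `k`. -/
def gridParam (n k T : ℕ) : ℚ := T * ((4 : ℕ) ^ ((n + 1) * k) : ℚ)⁻¹

/-- The point with parameter `gridParam n k T` on the `k`-th approximating curve. -/
noncomputable def gridPoint (n k T : ℕ) : EuclideanSpace ℝ (Fin n) :=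
  curveApproxPoint n k (gridParam n k T : ℝ)

/-- Squared distance between `gridPoint n k T` and the `c`-th rational point. -/
def gridDistSq (n k T c : ℕ) : ℚ :=
  ∑ i ∈ Finset.range n, (curveApprox n k i (gridParam n k T) - ratEnum (tupleEntry c i)) ^ 2

/-- Up to the error `1 / (k + 1)`, `gridPoint n k T` avoids the first `k` balls listed by the odd
entries of `p`.  The second condition bounds the parameter in terms of the point, so that parameters
of points in a bounded set stay bounded; see `admissible_iff` for the conditions in terms of
distances. -/
def Admissible (n : ℕ) (p : ℕ → ℕ) (k T : ℕ) : Prop :=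
  (∀ i < k, max 0 (nnratEnum (p (2 * i + 1)).unpair.2 - 1 / ((k : ℚ) + 1)) ^ 2 ≤
    gridDistSq n k T (p (2 * i + 1)).unpair.1) ∧
  gridParam n k T ^ 2 ≤ 2 * gridDistSq n k T 0 + 32

/-- The largest `T` that is considered on level `k`; the corresponding parameter is `k`. -/
def gridBound (n k : ℕ) : ℕ := k * 4 ^ ((n + 1) * k)

/-- Among the admissible points of level `k`, the `T`-th one is closest to the rational point coded
by `p (2 * k)`, which is the `k`-th approximation to the point to be projected. -/
def Optimal (n : ℕ) (p : ℕ → ℕ) (k T : ℕ) : Prop :=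
  Admissible n p k T ∧ ∀ T' < gridBound n k + 1, Admissible n p k T' →
    gridDistSq n k T (p (2 * k)) ≤ gridDistSq n k T' (p (2 * k))

open Classical in
/-- An optimal `T` of level `k`, and `0` if there is none. -/
noncomputable def optimalParam (n : ℕ) (p : ℕ → ℕ) (k : ℕ) : ℕ :=
  Nat.findGreatest (Optimal n p k) (gridBound n k)

section Computability

theorem admissible_congr (n : ℕ) {p p' : ℕ → ℕ} {k : ℕ} (h : ∀ e < 2 * k + 1, p e = p' e)
    (T : ℕ) : Admissible n p k T ↔ Admissible n p' k T := by
  refine and_congr_left fun _ => forall_congr' fun i => imp_congr_right fun hi => ?_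
  rw [h _ (by omega)]

theorem optimalParam_congr (n : ℕ) {p p' : ℕ → ℕ} {k : ℕ} (h : ∀ e < 2 * k + 1, p e = p' e) :
    optimalParam n p k = optimalParam n p' k := by
  have hopt : Optimal n p k = Optimal n p' k := by
    funext T
    simp only [Optimal, admissible_congr n h, h _ (Nat.lt_succ_self _)]
  rw [optimalParam, optimalParam, hopt]

theorem isReadingBound_optimalParam (n : ℕ) (f : ℕ × ℕ → ℕ) :
    IsReadingBound (fun m _ => 2 * m + 1)
      fun p m => f (m.unpair.1, optimalParam n p m.unpair.1) := fun p p' m h => by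
  have hle := Nat.unpair_left_le m
  exact congrArg (fun T => f (m.unpair.1, T)) (optimalParam_congr n fun e he =>
    h e (show e < 2 * m + 1 by omega))

variable {α : Type*} [Primcodable α] (n : ℕ) {w : α → List ℕ} {k T c : α → ℕ}

theorem primrec_gridExponent (hk : Primrec k) : Primrec fun x => (n + 1) * k x :=
  Primrec.nat_mul.comp (Primrec.const (n + 1)) hk

theorem primrec_gridBound (hk : Primrec k) : Primrec fun x => gridBound n (k x) :=
  Primrec.nat_mul.comp hk (primrec_nat_pow (Primrec.const 4) (primrec_gridExponent n hk))

theorem primrecRat_gridParam (hk : Primrec k) (hT : Primrec T) :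
    PrimrecRat fun x => gridParam n (k x) (T x) :=
  (PrimrecRat.natCast hT).mul
    (PrimrecRat.inv_natCast_pow 4 (by norm_num) (primrec_gridExponent n hk))

theorem primrecRat_gridDistSq (hk : Primrec k) (hT : Primrec T) (hc : Primrec c) :
    PrimrecRat fun x => gridDistSq n (k x) (T x) (c x) := by
  refine PrimrecRat.sum_range ?_ (Primrec.const n)
  have hcoord : PrimrecRat fun y : α × ℕ =>
      curveApprox n (k y.1) y.2 (gridParam n (k y.1) (T y.1)) :=
    .curveApprox n (hk.comp Primrec.fst) Primrec.snd
      (primrecRat_gridParam n (hk.comp Primrec.fst) (hT.comp Primrec.fst))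
  exact (hcoord.sub (PrimrecRat.ratEnum.comp
    (primrec_tupleEntry.comp (hc.comp Primrec.fst) Primrec.snd))).sq

theorem primrecPred_admissible (hw : Primrec w) (hk : Primrec k) (hT : Primrec T) :
    PrimrecPred fun x => Admissible n (zeroExtend (w x)) (k x) (T x) := by
  have hk' : Primrec fun y : α × ℕ => k y.1 := hk.comp Primrec.fst
  have hball : Primrec fun y : α × ℕ => zeroExtend (w y.1) (2 * y.2 + 1) :=
    primrec₂_zeroExtend.comp (hw.comp Primrec.fst) (Primrec.nat_double_succ.comp Primrec.snd)
  have hε : PrimrecRat fun y : α × ℕ => 1 / ((k y.1 : ℚ) + 1) :=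
    (PrimrecRat.natCast_div (Primrec.const 1) hk').of_eq fun y => by rw [Nat.cast_one]
  have hradius := PrimrecRat.nnratEnum.comp (primrec_unpair_snd hball)
  have havoid := ((PrimrecRat.const 0).max (hradius.sub hε)).sq.le
    (primrecRat_gridDistSq n hk' (hT.comp Primrec.fst) (primrec_unpair_fst hball))
  have hbound := (primrecRat_gridParam n hk hT).sq.le (((PrimrecRat.const 2).mul
    (primrecRat_gridDistSq n hk hT (Primrec.const 0))).add (PrimrecRat.const 32))
  exact (primrecPred_forall_lt havoid hk).and hbound

theorem primrecPred_optimal (hw : Primrec w) (hk : Primrec k) (hT : Primrec T) :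
    PrimrecPred fun x => Optimal n (zeroExtend (w x)) (k x) (T x) := by
  have hk' : Primrec fun y : α × ℕ => k y.1 := hk.comp Primrec.fst
  have hcentre : Primrec fun y : α × ℕ => zeroExtend (w y.1) (2 * k y.1) :=
    primrec₂_zeroExtend.comp (hw.comp Primrec.fst) (Primrec.nat_double.comp hk')
  have hle := (primrecRat_gridDistSq n hk' (hT.comp Primrec.fst) hcentre).le
    (primrecRat_gridDistSq n hk' Primrec.snd hcentre)
  exact (primrecPred_admissible n hw hk hT).and (primrecPred_forall_lt
    (primrecPred_imp (primrecPred_admissible n (hw.comp Primrec.fst) hk' Primrec.snd) hle)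
    (Primrec.succ.comp (primrec_gridBound n hk)))

theorem primrec_optimalParam (hw : Primrec w) (hk : Primrec k) :
    Primrec fun x => optimalParam n (zeroExtend (w x)) (k x) := by
  classical
  unfold optimalParam
  exact Primrec.nat_findGreatest (p := fun x T => Optimal n (zeroExtend (w x)) (k x) T)
    (primrec_gridBound n hk) (primrecPred_optimal n (hw.comp Primrec.fst) (hk.comp Primrec.fst)
      Primrec.snd).primrecRel

theorem exists_computable_optimalParam : ∃ H : (ℕ → ℕ) → ℕ → ℕ,
    BaireComputable (PFun.lift H) ∧ ∀ p, realSeq.cauchyRep.seq.IsName (H p)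
      fun k => (gridParam n k (optimalParam n p k) : ℝ) := by
  obtain ⟨f, hf, hfeq⟩ : PrimrecRat fun x : ℕ × ℕ => gridParam n x.1 x.2 :=
    primrecRat_gridParam n Primrec.fst Primrec.snd
  refine ⟨fun p m => f (m.unpair.1, optimalParam n p m.unpair.1), ?_, fun p k => ?_⟩
  · have hlevel : Primrec fun x : List ℕ × ℕ => x.2.unpair.1 := primrec_unpair_fst Primrec.snd
    exact (isReadingBound_optimalParam n f).baireComputable_lift
      (Primrec.nat_double_succ.comp₂ Primrec₂.left)
      (hf.comp (hlevel.pair (primrec_optimalParam n Primrec.fst hlevel)))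
  · refine realSeq.isName_of_dist_le fun i => ?_
    simp [realSeq, hfeq]

end Computability

theorem gridParam_eq_div (n k T : ℕ) : (gridParam n k T : ℝ) = T / 4 ^ ((n + 1) * k) := by
  simp [gridParam, div_eq_mul_inv]

theorem gridParam_nonneg (n k T : ℕ) : 0 ≤ (gridParam n k T : ℝ) := by
  rw [gridParam_eq_div]
  positivity

theorem le_gridBound_iff {n k T : ℕ} : T ≤ gridBound n k ↔ (gridParam n k T : ℝ) ≤ k := by
  rw [gridParam_eq_div, div_le_iff₀ (by positivity), gridBound]
  norm_cast

theorem ratCast_gridDistSq (n k T c : ℕ) :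
    (gridDistSq n k T c : ℝ) = dist (gridPoint n k T) ((euclideanSeq n).pt c) ^ 2 := by
  rw [dist_eq_norm, EuclideanSpace.norm_sq_eq, gridDistSq, Finset.sum_range]
  push_cast
  refine Finset.sum_congr rfl fun i _ => ?_
  rw [Real.norm_eq_abs, sq_abs]
  rfl

theorem admissible_iff {n : ℕ} {p : ℕ → ℕ} {k T : ℕ} : Admissible n p k T ↔
    (∀ i < k, (nnratEnum (p (2 * i + 1)).unpair.2 : ℝ) - 1 / ((k : ℝ) + 1) ≤
      dist (gridPoint n k T) ((euclideanSeq n).pt (p (2 * i + 1)).unpair.1)) ∧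
    (gridParam n k T : ℝ) ^ 2 ≤ 2 * ‖gridPoint n k T‖ ^ 2 + 32 := by
  refine and_congr (forall₂_congr fun i _ => ?_) ?_
  · rw [← Rat.cast_le (K := ℝ), ratCast_gridDistSq]
    push_cast
    rw [sq_le_sq₀ (le_max_left _ _) dist_nonneg, max_le_iff, and_iff_right dist_nonneg]
  · rw [← Rat.cast_le (K := ℝ)]
    push_cast
    rw [ratCast_gridDistSq, euclideanSeq_pt_zero, dist_zero_right]

theorem optimal_optimalParam {n : ℕ} {p : ℕ → ℕ} {k T : ℕ} (hT : T ≤ gridBound n k)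
    (h : Admissible n p k T) : Optimal n p k (optimalParam n p k) := by
  classical
  obtain ⟨T₀, hT₀, hmin⟩ := Finset.exists_min_image
    ((Finset.range (gridBound n k + 1)).filter (Admissible n p k))
    (fun T => gridDistSq n k T (p (2 * k)))
    ⟨T, Finset.mem_filter.mpr ⟨Finset.mem_range.mpr (Nat.lt_succ_of_le hT), h⟩⟩
  rw [Finset.mem_filter, Finset.mem_range] at hT₀
  exact Nat.findGreatest_spec (Nat.le_of_lt_succ hT₀.1) ⟨hT₀.2, fun T' hT' hadm =>
    hmin T' (Finset.mem_filter.mpr ⟨Finset.mem_range.mpr hT', hadm⟩)⟩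

theorem Optimal.dist_le {n : ℕ} {p : ℕ → ℕ} {k T T' : ℕ} (h : Optimal n p k T)
    (hT' : T' ≤ gridBound n k) (hadm : Admissible n p k T') :
    dist (gridPoint n k T) ((euclideanSeq n).pt (p (2 * k))) ≤
      dist (gridPoint n k T') ((euclideanSeq n).pt (p (2 * k))) := by
  have hsq := (Rat.cast_le (K := ℝ)).mpr (h.2 T' (Nat.lt_succ_of_le hT') hadm)
  rwa [ratCast_gridDistSq, ratCast_gridDistSq, sq_le_sq₀ dist_nonneg dist_nonneg] at hsq

theorem exists_dist_gridPoint_le {n N : ℕ} (hN : 0 < N) {a : EuclideanSpace ℝ (Fin n)}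
    (ha : ‖a‖ ≤ N) (k : ℕ) : ∃ T, (gridParam n k T : ℝ) ≤ N + 1 ∧
      dist (gridPoint n k T) a ≤ 12 * n * (N + 2) * (2 ^ k)⁻¹ := by
  obtain ⟨t, ⟨hNt, htN⟩, rfl⟩ := exists_curvePoint_eq hN ha
  have ht : 0 ≤ t := N.cast_nonneg.trans hNt
  have hpow : (0 : ℝ) < 4 ^ ((n + 1) * k) := by positivity
  set T := ⌊t * 4 ^ ((n + 1) * k)⌋₊
  have hle : (gridParam n k T : ℝ) ≤ t := by
    rw [gridParam_eq_div, div_le_iff₀ hpow]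
    exact Nat.floor_le (mul_nonneg ht hpow.le)
  have hlt : t < gridParam n k T + (4 ^ ((n + 1) * k))⁻¹ := by
    rw [gridParam_eq_div, ← one_div, ← add_div, lt_div_iff₀ hpow]
    exact Nat.lt_floor_add_one _
  refine ⟨T, hle.trans htN, ?_⟩
  calc dist (gridPoint n k T) (curvePoint n t) ≤ 12 * n * (|t| + 1) * (2 ^ k)⁻¹ :=
        dist_curveApproxPoint_curvePoint_le
          (abs_le.mpr ⟨by linarith, by linarith [inv_pos.mpr hpow]⟩)
    _ ≤ 12 * n * (N + 2) * (2 ^ k)⁻¹ := by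
        gcongr 12 * n * ?_ * (2 ^ k)⁻¹
        rw [abs_of_nonneg ht]
        linarith

theorem admissible_of_dist_le {n : ℕ} {p : ℕ → ℕ} {k T : ℕ} {a : EuclideanSpace ℝ (Fin n)}
    (ha : ∀ i, a ∉ (euclideanSeq n).basicBall (p (2 * i + 1)))
    (hdist : dist (gridPoint n k T) a ≤ 1 / ((k : ℝ) + 1))
    (hparam : (gridParam n k T : ℝ) ≤ ‖a‖ + 3) : Admissible n p k T := by
  refine admissible_iff.mpr ⟨fun i _ => ?_, ?_⟩
  · have hball := ha i
    rw [DenseSequence.basicBall, Metric.mem_ball, not_lt] at hball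
    linarith [dist_triangle_left a ((euclideanSeq n).pt (p (2 * i + 1)).unpair.1) (gridPoint n k T)]
  · have hε : 1 / ((k : ℝ) + 1) ≤ 1 :=
      div_le_one_of_le₀ (by linarith [k.cast_nonneg (α := ℝ)]) (by positivity)
    have hnorm : ‖a‖ ≤ ‖gridPoint n k T‖ + 1 := by
      rw [dist_comm, dist_eq_norm] at hdist
      linarith [norm_le_norm_add_norm_sub' a (gridPoint n k T)]
    calc (gridParam n k T : ℝ) ^ 2 ≤ (‖gridPoint n k T‖ + 4) ^ 2 :=
          pow_le_pow_left₀ (gridParam_nonneg n k T) (by linarith) 2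
      _ ≤ 2 * ‖gridPoint n k T‖ ^ 2 + 32 := by
          linarith [sq_nonneg (‖gridPoint n k T‖ - 4)]

theorem eventually_mul_inv_two_pow_le (C : ℝ) :
    ∀ᶠ k : ℕ in atTop, C * (2 ^ k)⁻¹ ≤ 1 / ((k : ℝ) + 1) := by
  have hlim : Tendsto (fun k : ℕ => C * ((k + 1) * (2 ^ k)⁻¹)) atTop (𝓝 0) := by
    have hself : Tendsto (fun k : ℕ => (k : ℝ) * 2⁻¹ ^ k) atTop (𝓝 0) :=
      tendsto_self_mul_const_pow_of_lt_one (by norm_num) (by norm_num)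
    have hpow : Tendsto (fun k : ℕ => (2⁻¹ : ℝ) ^ k) atTop (𝓝 0) :=
      tendsto_pow_atTop_nhds_zero_of_lt_one (by norm_num) (by norm_num)
    simpa [add_mul] using (hself.add hpow).const_mul C
  filter_upwards [hlim.eventually (gt_mem_nhds one_pos)] with k hk
  rw [le_div_iff₀ (by positivity)]
  linarith

theorem eventually_exists_admissible {n : ℕ} {p : ℕ → ℕ} {a : EuclideanSpace ℝ (Fin n)}
    (ha : ∀ i, a ∉ (euclideanSeq n).basicBall (p (2 * i + 1))) :
    ∀ᶠ k in atTop, ∃ T ≤ gridBound n k, Admissible n p k T ∧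
      dist (gridPoint n k T) a ≤ 1 / ((k : ℝ) + 1) := by
  set N := ⌈‖a‖⌉₊ + 1
  have hNle : ‖a‖ ≤ N := (Nat.le_ceil ‖a‖).trans (by exact_mod_cast Nat.le_succ _)
  have hNge : (N : ℝ) ≤ ‖a‖ + 2 := by
    push_cast [N]
    linarith [Nat.ceil_lt_add_one (norm_nonneg a)]
  filter_upwards [eventually_mul_inv_two_pow_le (12 * n * (N + 2)), eventually_ge_atTop (N + 1)]
    with k hk hkN
  obtain ⟨T, hparam, hdist⟩ := exists_dist_gridPoint_le (Nat.succ_pos _) hNle k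
  exact ⟨T, le_gridBound_iff.mpr (hparam.trans (by exact_mod_cast hkN)),
    admissible_of_dist_le ha (hdist.trans hk) (by linarith), hdist.trans hk⟩

theorem tendsto_curveApproxPoint (n : ℕ) {l : Filter ℕ} (hl : l ≤ atTop) {s : ℕ → ℝ} {t : ℝ}
    (hs : Tendsto s l (𝓝 t)) :
    Tendsto (fun k => curveApproxPoint n k (s k)) l (𝓝 (curvePoint n t)) := by
  have hpow : Tendsto (fun k : ℕ => ((2 : ℝ) ^ k)⁻¹) l (𝓝 0) := by
    simpa using (tendsto_pow_atTop_nhds_zero_of_lt_one (r := (2 : ℝ)⁻¹) (by norm_num)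
      (by norm_num)).mono_left hl
  have herror : Tendsto (fun k => 12 * n * (|s k| + 1) * ((2 : ℝ) ^ k)⁻¹) l (𝓝 0) := by
    simpa using ((hs.abs.add_const 1).const_mul (12 * n : ℝ)).mul hpow
  refine (tendsto_iff_of_dist (squeeze_zero (fun _ => dist_nonneg) (fun k => ?_) herror)).mpr
    (((continuous_curvePoint n).tendsto t).comp hs)
  exact dist_curveApproxPoint_curvePoint_le (by simp)

section Projection

variable {n : ℕ} {p : ℕ → ℕ} {x a : EuclideanSpace ℝ (Fin n)}

theorem eventually_admissible_optimalParam
    (hx : (euclideanSeq n).cauchyRep.IsName (fun i => p (2 * i)) x)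
    (ha : ∀ i, a ∉ (euclideanSeq n).basicBall (p (2 * i + 1))) :
    ∀ᶠ k in atTop, Admissible n p k (optimalParam n p k) ∧
      dist (gridPoint n k (optimalParam n p k)) x ≤
        1 / ((k : ℝ) + 1) + dist x a + 2 * 2⁻¹ ^ k := by
  filter_upwards [eventually_exists_admissible ha] with k ⟨T, hT, hadm, hdist⟩
  have hopt := optimal_optimalParam hT hadm
  refine ⟨hopt.1, ?_⟩
  set c := (euclideanSeq n).pt (p (2 * k))
  have hcx : dist c x ≤ 2⁻¹ ^ k := (euclideanSeq n).dist_le_of_isName hx k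
  calc dist (gridPoint n k (optimalParam n p k)) x
      ≤ dist (gridPoint n k (optimalParam n p k)) c + dist c x := dist_triangle _ _ _
    _ ≤ dist (gridPoint n k T) c + dist c x := by
        gcongr
        exact hopt.dist_le hT hadm
    _ ≤ dist (gridPoint n k T) a + dist x a + dist c x + dist c x := by
        gcongr
        rw [dist_comm x a, dist_comm c x]
        exact dist_triangle4 _ _ _ _
    _ ≤ 1 / ((k : ℝ) + 1) + dist x a + 2 * 2⁻¹ ^ k := by linarith

theorem tendsto_optimalParam_dist_bound (d : ℝ) :
    Tendsto (fun k : ℕ => 1 / ((k : ℝ) + 1) + d + 2 * 2⁻¹ ^ k) atTop (𝓝 d) := by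
  have hpow : Tendsto (fun k : ℕ => (2⁻¹ : ℝ) ^ k) atTop (𝓝 0) :=
    tendsto_pow_atTop_nhds_zero_of_lt_one (by norm_num) (by norm_num)
  simpa using (tendsto_one_div_add_atTop_nhds_zero_nat.add_const d).add (hpow.const_mul 2)

theorem isCompact_closure_range_gridParam_optimalParam
    (hx : (euclideanSeq n).cauchyRep.IsName (fun i => p (2 * i)) x)
    (ha : ∀ i, a ∉ (euclideanSeq n).basicBall (p (2 * i + 1))) :
    IsCompact (closure (Set.range fun k => (gridParam n k (optimalParam n p k) : ℝ))) := by
  obtain ⟨C, hC⟩ := (tendsto_optimalParam_dist_bound (dist x a)).bddAbove_range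
  have hbdd : IsBoundedUnder (· ≤ ·) atTop fun k =>
      ‖(gridParam n k (optimalParam n p k) : ℝ)‖ := by
    refine ⟨√(2 * (C + ‖x‖) ^ 2 + 32), eventually_map.mpr ?_⟩
    filter_upwards [eventually_admissible_optimalParam hx ha] with k ⟨hadm, hdist⟩
    have hnorm : ‖gridPoint n k (optimalParam n p k)‖ ≤ C + ‖x‖ := by
      have hdistC := hdist.trans (hC ⟨k, rfl⟩)
      rw [dist_eq_norm] at hdistC
      linarith [norm_le_norm_sub_add (gridPoint n k (optimalParam n p k)) x]
    refine Real.abs_le_sqrt ((admissible_iff.mp hadm).2.trans ?_)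
    gcongr
  obtain ⟨M, hM⟩ := hbdd.bddAbove_range
  refine (isBounded_iff_forall_norm_le.mpr ⟨M, ?_⟩).isCompact_closure
  rintro _ ⟨k, rfl⟩
  exact hM ⟨k, rfl⟩

variable {t : ℝ}

theorem curvePoint_notMem_basicBall
    (hx : (euclideanSeq n).cauchyRep.IsName (fun i => p (2 * i)) x)
    (ha : ∀ i, a ∉ (euclideanSeq n).basicBall (p (2 * i + 1)))
    (ht : MapClusterPt t atTop fun k => (gridParam n k (optimalParam n p k) : ℝ)) (i : ℕ) :
    curvePoint n t ∉ (euclideanSeq n).basicBall (p (2 * i + 1)) := by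
  obtain ⟨U, hU, hUt⟩ := mapClusterPt_iff_ultrafilter.mp ht
  rw [DenseSequence.basicBall, Metric.mem_ball, not_lt]
  have hradius := (tendsto_one_div_add_atTop_nhds_zero_nat (𝕜 := ℝ)).mono_left hU
    |>.const_sub (nnratEnum (p (2 * i + 1)).unpair.2 : ℝ)
  rw [sub_zero] at hradius
  refine le_of_tendsto_of_tendsto hradius
    ((tendsto_curveApproxPoint n hU hUt).dist tendsto_const_nhds) ?_
  filter_upwards [hU (eventually_admissible_optimalParam hx ha), hU (eventually_gt_atTop i)]
    with k ⟨hadm, _⟩ hik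
  exact (admissible_iff.mp hadm).1 i hik

theorem dist_curvePoint_le
    (hx : (euclideanSeq n).cauchyRep.IsName (fun i => p (2 * i)) x)
    (ha : ∀ i, a ∉ (euclideanSeq n).basicBall (p (2 * i + 1)))
    (ht : MapClusterPt t atTop fun k => (gridParam n k (optimalParam n p k) : ℝ)) :
    dist x (curvePoint n t) ≤ dist x a := by
  obtain ⟨U, hU, hUt⟩ := mapClusterPt_iff_ultrafilter.mp ht
  rw [dist_comm x (curvePoint n t)]
  refine le_of_tendsto_of_tendsto
    ((tendsto_curveApproxPoint n hU hUt).dist tendsto_const_nhds)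
    ((tendsto_optimalParam_dist_bound (dist x a)).mono_left hU) ?_
  filter_upwards [hU (eventually_admissible_optimalParam hx ha)] with k hk using hk.2

end Projection

theorem projNeg_reducible_bwt (n : ℕ) :
    StrongWeihrauchReducible (projNeg (euclideanSeq n)) (BWT realSeq) := by
  obtain ⟨H, hH, hHname⟩ := exists_computable_optimalParam n
  obtain ⟨K, hK, hKname⟩ := exists_computable_curvePoint n
  refine .of_lift hH hK ?_
  rintro p ⟨(x : EuclideanSpace ℝ (Fin n)), (A : Closeds (EuclideanSpace ℝ (Fin n)))⟩ ⟨hx, hA⟩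
    ⟨a, (haA : a ∈ A), hdist⟩
  have hmem (z) : z ∈ A ↔ ∀ i, z ∉ (euclideanSeq n).basicBall (p (2 * i + 1)) := by
    have hcompl : (A : Set (EuclideanSpace ℝ (Fin n))) = (⋃ i, _)ᶜ := hA
    rw [← SetLike.mem_coe, hcompl, Set.mem_compl_iff, Set.mem_iUnion, not_exists]
  have ha := (hmem a).mp haA
  have hcompact := isCompact_closure_range_gridParam_optimalParam hx ha
  refine ⟨_, hHname p, ?_, ?_⟩
  · obtain ⟨t, -, φ, hφ, ht⟩ :=
      hcompact.tendsto_subseq fun k => subset_closure (Set.mem_range_self k)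
    exact ⟨t, hcompact, ht.mapClusterPt.of_comp hφ.tendsto_atTop⟩
  · rintro q (t : ℝ) ⟨-, ht⟩ hq
    have hA' : curvePoint n t ∈ A := (hmem _).mpr (curvePoint_notMem_basicBall hx ha ht)
    exact ⟨curvePoint n t, ⟨hA', le_antisymm ((dist_curvePoint_le hx ha ht).trans_eq hdist)
      (Metric.infDist_le_dist_of_mem hA')⟩, hKname q t hq⟩

theorem mainTheorem2 (n : ℕ) (hn : 2 ≤ n) :
    StrongWeihrauchEquiv (projNeg (euclideanSeq n)) (BWT realSeq) :=
  ⟨projNeg_reducible_bwt n, bwt_reducible_projNeg hn⟩
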